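/- **Setting.** Let $n,m\ge 0$ and $s_1,\dots,s_m\ge 0$ be integers and $s=\sum_i s_i$. Let $A\in\mathbb R^{n\times n}$, $C^{(i)}\in\mathbb R^{s_i\times n}$ $(1\le i\le m)$, and let $Q,\Sigma_0\in\mathbb R^{n\times n}$, $R\in\mathbb R^{s\times s}$, $Y^{(i)}\in\mathbb R^{s_i\times s_i}$ be symmetric positive definite. Consider $$x_{k+1}=Ax_k+w_k,\qquad y_k^{(i)}=C^{(i)}x_k+v_k^{(i)},\qquad i=1,\dots,m,\ k\ge 0,$$ and put $v_k=[v_k^{(1)\prime},\dots,v_k^{(m)\prime}]'$, $y_k=[y_k^{(1)\prime},\dots,y_k^{(m)\prime}]'$, $C=[C^{(1)\prime},\dots,C^{(m)\prime}]'$, $Y=\mathrm{diag}(Y^{(1)},\dots,Y^{(m)})$. The vectors $x_0,w_0,w_1,\dots,v_0,v_1,\dots$ are jointly Gaussian with mean zero and pairwise uncorrelated, with $\mathrm{Cov}(x_0)=\Sigma_0$, $\mathrm{Cov}(w_k)=Q$, $\mathrm{Cov}(v_k)=R$ for all $k$. The variables $\zeta_k^{(i)}$ $(k\ge0,\ 1\le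 i\le m)$ are i.i.d. uniform on $[0,1]$, and the family of all of them is independent of $(x_0,(w_k)_k,(v_k)_k)$. At time $k$, sensor $i$ transmits $y_k^{(i)}$ $(\gamma_k^{(i)}=1)$ if $\zeta_k^{(i)}>\exp\!\big(-\tfrac12 y_k^{(i)\prime}Y^{(i)}y_k^{(i)}\big)$ and does not transmit $(\gamma_k^{(i)}=0)$ otherwise. Let $\mathcal I_k$ consist of the decisions $\gamma_j=(\gamma_j^{(1)},\dots,\gamma_j^{(m)})$ and of the transmitted measurements $y_j^{(i)}$ (those with $\gamma_j^{(i)}=1$), for $0\le j\le k$, and let $\mathcal I_{-1}=\emptyset$. Let $$\hat x_k^-=\mathbb E[x_k\mid\mathcal I_{k-1}],\quad P_k^-=\mathbb E[(x_k-\hat x_k^-)(x_k-\hat x_k^-)'\mid\mathcal I_{k-1}],\quad \hat x_k=\mathbb E[x_k\mid\mathcal I_k],\quad P_k=\mathbb E[(x_k-\hat x_k)(x_k-\hat x_k)'\mid\mathcal I_k]$$ be the a priori and a posteriori MMSE estimates and their conditional error covariances, and let $\Psi_k=\mathrm{diag}(\gamma_k^{(1)}I_{s_1},\dots,\gamma_k^{(m)}I_{s_m})$.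 **Theorem.** Each $x_k$ is square integrable, and almost surely $\hat x_0^-=0$, $P_0^-=\Sigma_0$, and for every $k\ge 0$ the following hold. 1. The matrices $P_k^-$ and $P_k$ are positive definite, the conditional law of $x_k$ given $\mathcal I_{k-1}$ is $\mathcal N(\hat x_k^-,P_k^-)$, and the conditional law of $x_k$ given $\mathcal I_k$ is $\mathcal N(\hat x_k,P_k)$. 2. Time update: $\hat x_{k+1}^-=A\hat x_k$ and $P_{k+1}^-=AP_kA'+Q$. 3. Measurement update: $$\hat x_k=\hat x_k^-+P_k^-C'\big(CP_k^-C'+R+(I-\Psi_k)Y^{-1}\big)^{-1}(\Psi_ky_k-C\hat x_k^-),$$ $$P_k=P_k^--P_k^-C'\big(CP_k^-C'+R+(I-\Psi_k)Y^{-1}\big)^{-1}CP_k^-.$$ -/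

import Mathlib

open MeasureTheory ProbabilityTheory Matrix

namespace EventEstimation

/-- Coordinates of the stacked measurement vector: pairs of a sensor `i` and a coordinate of the
`i`-th measurement, which has dimension `s i`. -/
abbrev MeasIdx {m : ℕ} (s : Fin m → ℕ) : Type := (i : Fin m) × Fin (s i)

/-- The deterministic data of the system: `A`, the sensor matrices `C i`, the noise covariances
`Q` and `R` (the measurement noises of different sensors may be correlated), the covariance `S0`
of the initial state, and the trigger parameters `Y i`. -/
structure SensorSystem (n m : ℕ) (s : Fin m → ℕ) where
  A : Matrix (Fin n) (Fin n) ℝ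
  C : (i : Fin m) → Matrix (Fin (s i)) (Fin n) ℝ
  Q : Matrix (Fin n) (Fin n) ℝ
  R : Matrix (MeasIdx s) (MeasIdx s) ℝ
  S0 : Matrix (Fin n) (Fin n) ℝ
  Y : (i : Fin m) → Matrix (Fin (s i)) (Fin (s i)) ℝ
  posDef_Q : Q.PosDef
  posDef_R : R.PosDef
  posDef_S0 : S0.PosDef
  posDef_Y : ∀ i, (Y i).PosDef

/-- The random inputs: initial state, process noise, stacked measurement noise, and the variables
with which the sensors randomize their decisions. -/
structure RandomInputs (Ω : Type*) [MeasurableSpace Ω] (n m : ℕ) (s : Fin m → ℕ) where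
  x0 : Ω → EuclideanSpace ℝ (Fin n)
  w : ℕ → Ω → EuclideanSpace ℝ (Fin n)
  v : ℕ → Ω → EuclideanSpace ℝ (MeasIdx s)
  ζ : ℕ → Fin m → Ω → ℝ
  measurable_x0 : Measurable x0
  measurable_w : ∀ k, Measurable (w k)
  measurable_v : ∀ k, Measurable (v k)
  measurable_ζ : ∀ k i, Measurable (ζ k i)

/-- Labels of all the scalar Gaussian inputs: the coordinates of the initial state, of the process
noises and of the measurement noises at all times. -/
inductive GaussianLabel (n : ℕ) {m : ℕ} (s : Fin m → ℕ) : Type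
  | init (i : Fin n) : GaussianLabel n s
  | proc (k : ℕ) (i : Fin n) : GaussianLabel n s
  | meas (k : ℕ) (p : MeasIdx s) : GaussianLabel n s

section

variable {Ω : Type*} [MeasurableSpace Ω] {n m : ℕ} {s : Fin m → ℕ}

/-- The scalar Gaussian input with a given label. -/
def RandomInputs.gaussianInput (I : RandomInputs Ω n m s) : GaussianLabel n s → Ω → ℝ
  | .init i => fun ω => I.x0 ω i
  | .proc k i => fun ω => I.w k ω i
  | .meas k p => fun ω => I.v k ω p

/-- The covariances of the Gaussian inputs: `S0`, `Q` and `R` for the initial state and for the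
noises at one and the same time, and `0` otherwise (uncorrelated). -/
def SensorSystem.inputCov (S : SensorSystem n m s) : GaussianLabel n s → GaussianLabel n s → ℝ
  | .init i, .init j => S.S0 i j
  | .proc k i, .proc l j => if k = l then S.Q i j else 0
  | .meas k p, .meas l q => if k = l then S.R p q else 0
  | _, _ => 0

/-- The stochastic model: the initial state and the noises are jointly Gaussian with mean zero,
mutually uncorrelated, and with covariances `S0`, `Q`, `R`; the variables `ζ k i` are i.i.d.
uniform on `[0, 1]` and independent of the initial state and the noises. -/
structure IsModel (S : SensorSystem n m s) (I : RandomInputs Ω n m s) (P : Measure Ω) : Prop where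
  gaussian : IsGaussianProcess I.gaussianInput P
  mean_zero : ∀ a, P[I.gaussianInput a] = 0
  cov_eq : ∀ a b, cov[I.gaussianInput a, I.gaussianInput b; P] = S.inputCov a b
  uniform : ∀ k i, pdf.IsUniform (I.ζ k i) (Set.Icc 0 1) P volume
  indep_ζ : iIndepFun (fun p : ℕ × Fin m => I.ζ p.1 p.2) P
  indep_gaussian_ζ : IndepFun (fun ω a => I.gaussianInput a ω)
    (fun ω (p : ℕ × Fin m) => I.ζ p.1 p.2 ω) P

/-- The stacked measurement matrix. -/
def SensorSystem.stackedC (S : SensorSystem n m s) : Matrix (MeasIdx s) (Fin n) ℝ :=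
  Matrix.of fun p j => S.C p.1 p.2 j

/-- The block diagonal matrix of the trigger parameters. -/
def SensorSystem.blockY (S : SensorSystem n m s) : Matrix (MeasIdx s) (MeasIdx s) ℝ :=
  Matrix.blockDiagonal' S.Y

/-- The state `x k`: `x 0 = x0` and `x (k + 1) = A x k + w k`. -/
noncomputable def state (S : SensorSystem n m s) (I : RandomInputs Ω n m s) :
    ℕ → Ω → EuclideanSpace ℝ (Fin n)
  | 0 => I.x0
  | k + 1 => fun ω => S.A.toEuclideanLin (state S I k ω) + I.w k ω

/-- The part of the measurement noise at time `k` that belongs to sensor `i`. -/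
noncomputable def RandomInputs.sensorNoise (I : RandomInputs Ω n m s) (k : ℕ) (i : Fin m) (ω : Ω) :
    EuclideanSpace ℝ (Fin (s i)) :=
  WithLp.toLp 2 fun j => I.v k ω ⟨i, j⟩

/-- The measurement of sensor `i` at time `k`. -/
noncomputable def sensorMeas (S : SensorSystem n m s) (I : RandomInputs Ω n m s) (k : ℕ)
    (i : Fin m) (ω : Ω) : EuclideanSpace ℝ (Fin (s i)) :=
  (S.C i).toEuclideanLin (state S I k ω) + I.sensorNoise k i ω

/-- The stacked measurement vector at time `k`. -/
noncomputable def stackedMeas (S : SensorSystem n m s) (I : RandomInputs Ω n m s) (k : ℕ)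
    (ω : Ω) : EuclideanSpace ℝ (MeasIdx s) :=
  WithLp.toLp 2 fun p => sensorMeas S I k p.1 ω p.2

/-- The probability `exp (- (1 / 2) * y' Y y)` of dropping the measurement `y` of sensor `i`. -/
noncomputable def dropProb (S : SensorSystem n m s) (i : Fin m)
    (y : EuclideanSpace ℝ (Fin (s i))) : ℝ :=
  Real.exp (-(1 / 2) * (y.ofLp ⬝ᵥ S.Y i *ᵥ y.ofLp))

/-- The decision of sensor `i` at time `k`: `true` (transmission) if the uniform variable exceeds
the drop probability of the current measurement, `false` (no transmission) otherwise. -/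
noncomputable def decision (S : SensorSystem n m s) (I : RandomInputs Ω n m s) (k : ℕ)
    (ω : Ω) (i : Fin m) : Bool :=
  decide (dropProb S i (sensorMeas S I k i ω) < I.ζ k i ω)

/-- What the estimator can receive at one time: the decisions of all the sensors, and the
measurement vectors of exactly those sensors that transmit. -/
abbrev Packet {m : ℕ} (s : Fin m → ℕ) : Type :=
  (g : Fin m → Bool) × ((i : {i : Fin m // g i = true}) → EuclideanSpace ℝ (Fin (s i)))

/-- What the estimator receives at time `k`. -/
noncomputable def packet (S : SensorSystem n m s) (I : RandomInputs Ω n m s) (k : ℕ) (ω : Ω) :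
    Packet s :=
  ⟨decision S I k ω, fun i => sensorMeas S I k i ω⟩

/-- The information received at the times `0, …, k - 1` (nothing for `k = 0`). -/
noncomputable def info (S : SensorSystem n m s) (I : RandomInputs Ω n m s) (k : ℕ) (ω : Ω) :
    Fin k → Packet s :=
  fun j => packet S I j ω

/-- The σ-algebra generated by the information received at the times `0, …, k - 1`. -/
@[reducible] noncomputable def infoSigma (S : SensorSystem n m s) (I : RandomInputs Ω n m s) (k : ℕ) :
    MeasurableSpace Ω :=
  MeasurableSpace.comap (info S I k) inferInstance

/-- The estimate of the state at time `k` from the information received at the times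
`0, …, l - 1`: the conditional expectation. -/
noncomputable def estimate (S : SensorSystem n m s) (I : RandomInputs Ω n m s) (P : Measure Ω)
    (k l : ℕ) : Ω → EuclideanSpace ℝ (Fin n) :=
  P[state S I k | infoSigma S I l]

/-- The conditional covariance matrix of the error of `estimate S I P k l` given the information
received at the times `0, …, l - 1`. -/
noncomputable def errorCov (S : SensorSystem n m s) (I : RandomInputs Ω n m s) (P : Measure Ω)
    (k l : ℕ) (ω : Ω) : Matrix (Fin n) (Fin n) ℝ :=
  Matrix.of fun i j =>
    (P[fun ω' => (state S I k ω' i - estimate S I P k l ω' i) *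
        (state S I k ω' j - estimate S I P k l ω' j) | infoSigma S I l]) ω

/-- The a priori estimate of the state at time `k`, from the information before time `k`. -/
noncomputable def priorMean (S : SensorSystem n m s) (I : RandomInputs Ω n m s) (P : Measure Ω)
    (k : ℕ) : Ω → EuclideanSpace ℝ (Fin n) :=
  estimate S I P k k

/-- The conditional error covariance of the a priori estimate at time `k`. -/
noncomputable def priorCov (S : SensorSystem n m s) (I : RandomInputs Ω n m s) (P : Measure Ω)
    (k : ℕ) : Ω → Matrix (Fin n) (Fin n) ℝ :=
  errorCov S I P k k

/-- The a posteriori estimate of the state at time `k`, from the information up to and including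
time `k`. -/
noncomputable def postMean (S : SensorSystem n m s) (I : RandomInputs Ω n m s) (P : Measure Ω)
    (k : ℕ) : Ω → EuclideanSpace ℝ (Fin n) :=
  estimate S I P k (k + 1)

/-- The conditional error covariance of the a posteriori estimate at time `k`. -/
noncomputable def postCov (S : SensorSystem n m s) (I : RandomInputs Ω n m s) (P : Measure Ω)
    (k : ℕ) : Ω → Matrix (Fin n) (Fin n) ℝ :=
  errorCov S I P k (k + 1)

/-- The block diagonal matrix with the blocks `γ i • 1`, where `γ i` is `1` if sensor `i`
transmits at time `k` and `0` otherwise. -/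
noncomputable def decisionMatrix (S : SensorSystem n m s) (I : RandomInputs Ω n m s) (k : ℕ)
    (ω : Ω) : Matrix (MeasIdx s) (MeasIdx s) ℝ :=
  Matrix.blockDiagonal' fun i =>
    (if decision S I k ω i = true then (1 : ℝ) else 0) • (1 : Matrix (Fin (s i)) (Fin (s i)) ℝ)

/-- The gain `P⁻ C' (C P⁻ C' + R + (1 - Ψ) Y⁻¹)⁻¹` of the measurement update at time `k`. -/
noncomputable def gain (S : SensorSystem n m s) (I : RandomInputs Ω n m s) (P : Measure Ω)
    (k : ℕ) (ω : Ω) : Matrix (Fin n) (MeasIdx s) ℝ :=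
  priorCov S I P k ω * S.stackedCᵀ *
    (S.stackedC * priorCov S I P k ω * S.stackedCᵀ + S.R +
      (1 - decisionMatrix S I k ω) * S.blockY⁻¹)⁻¹

end

end EventEstimation

-- The trigger is chosen so that silence preserves Gaussianity. Given its measurement `y`, a sensor
-- stays silent with probability `exp (-y' Y y / 2)`, itself an unnormalised Gaussian weight. The
-- transmitting sensors contribute factors `1 - exp (-y' Y y / 2)`, which depend only on received
-- data and therefore cancel in the conditional law of the state. For the silent sensors the unseen
-- coordinates are integrated out against the product of that weight and the noise density.
-- Completing the square and the Woodbury identity turn the result into a Gaussian likelihood with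
-- noise covariance `R + (1 - Ψ) Y⁻¹`, evaluated at the measurement with zeros in place of the
-- missing coordinates. Thus silence acts like receiving the value zero with additional noise of
-- covariance `Y⁻¹`, and the Kalman formulas apply. Only `Y` has to be block diagonal with respect
-- to the sensors; `R` may couple them.
--
-- The induction carries the statement `CondGaussian`: given the packets, the state is Gaussian with
-- a mean that is a measurable function of the packets and a covariance that is a function of the
-- decisions alone. Since there are finitely many decision patterns up to a given time, the
-- covariance causes no measurability difficulties.
--
-- Conditional laws are handled through integrals against product test functions. The static
-- identity is `lintegral_gaussian_partial_observation`; summing it over all decision patterns gives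
-- `lintegral_packet_update`. Independence of the current noise and randomizers from the past
-- (`IsModel.indepFun_past_measurement`) lifts this to `IsModel.condGaussian_measurement`. The time
-- update `IsModel.condGaussian_time` convolves with the independent process noise. Finally,
-- uniqueness of conditional distributions identifies the conditional moments in the statement with
-- the parameters of the recursion.

set_option linter.unusedSectionVars false

open scoped ENNReal RealInnerProductSpace MatrixOrder

-- Gaussian weights and completing the square.

section QuadraticForms

variable {ι κ : Type*} [Fintype ι] [DecidableEq ι] [Fintype κ] [DecidableEq κ]

/-- The unnormalised Gaussian weight `exp (-u' H u / 2)`. -/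
noncomputable def expQuad (H : Matrix ι ι ℝ) (u : ι → ℝ) : ℝ≥0∞ :=
  ENNReal.ofReal (Real.exp (-(1 / 2) * (u ⬝ᵥ H *ᵥ u)))

@[fun_prop]
lemma continuous_expQuad (H : Matrix ι ι ℝ) : Continuous (expQuad H) := by
  unfold expQuad
  refine ENNReal.continuous_ofReal.comp (Real.continuous_exp.comp ?_)
  exact continuous_const.mul
    (continuous_id.dotProduct (continuous_const.matrix_mulVec continuous_id))

@[fun_prop]
lemma measurable_expQuad (H : Matrix ι ι ℝ) : Measurable (expQuad H) :=
  (continuous_expQuad H).measurable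

lemma expQuad_mul_expQuad (H : Matrix ι ι ℝ) (K : Matrix κ κ ℝ) (u : ι → ℝ) (v : κ → ℝ) :
    expQuad H u * expQuad K v =
      ENNReal.ofReal (Real.exp (-(1 / 2) * (u ⬝ᵥ H *ᵥ u + v ⬝ᵥ K *ᵥ v))) := by
  rw [expQuad, expQuad, ← ENNReal.ofReal_mul (Real.exp_nonneg _), ← Real.exp_add]
  congr 2
  ring

lemma dotProduct_mulVec_comm_of_isSymm {M : Matrix ι ι ℝ} (hM : Mᵀ = M) (x y : ι → ℝ) :
    x ⬝ᵥ M *ᵥ y = y ⬝ᵥ M *ᵥ x := by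
  rw [dotProduct_mulVec, ← mulVec_transpose, hM, dotProduct_comm]

lemma quadForm_add {M : Matrix ι ι ℝ} (hM : Mᵀ = M) (x y : ι → ℝ) :
    (x + y) ⬝ᵥ M *ᵥ (x + y) = x ⬝ᵥ M *ᵥ x + 2 * (y ⬝ᵥ M *ᵥ x) + y ⬝ᵥ M *ᵥ y := by
  simp only [mulVec_add, add_dotProduct, dotProduct_add]
  rw [dotProduct_mulVec_comm_of_isSymm hM x y]
  ring

lemma Matrix.PosDef.transpose_eq {M : Matrix ι ι ℝ} (hM : M.PosDef) : Mᵀ = M := by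
  have h := hM.isHermitian.eq
  rwa [conjTranspose_eq_transpose_of_trivial] at h

lemma Matrix.PosDef.add_transpose_mul_mul {Y : Matrix κ κ ℝ} {R : Matrix ι ι ℝ} (hY : Y.PosDef)
    (hR : R.PosDef) (E : Matrix ι κ ℝ) : (Y + Eᵀ * R * E).PosDef := by
  refine hY.add_posSemidef ?_
  have h := hR.posSemidef.conjTranspose_mul_mul_same E
  rwa [conjTranspose_eq_transpose_of_trivial] at h

lemma Matrix.PosDef.add_mul_mul_transpose {Y : Matrix κ κ ℝ} {R : Matrix ι ι ℝ} (hY : Y.PosDef)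
    (hR : R.PosDef) (E : Matrix ι κ ℝ) : (R + E * Y * Eᵀ).PosDef := by
  simpa using hR.add_transpose_mul_mul hY Eᵀ

/-- The Woodbury identity for positive definite matrices. -/
lemma inv_add_mul_inv_mul_transpose {Y : Matrix κ κ ℝ} {R : Matrix ι ι ℝ} (hY : Y.PosDef)
    (hR : R.PosDef) (E : Matrix ι κ ℝ) :
    (R + E * Y⁻¹ * Eᵀ)⁻¹ = R⁻¹ - R⁻¹ * E * (Y + Eᵀ * R⁻¹ * E)⁻¹ * Eᵀ * R⁻¹ := by
  have hYY : Y⁻¹⁻¹ = Y := nonsing_inv_nonsing_inv Y ((isUnit_iff_isUnit_det _).1 hY.isUnit)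
  have h := Matrix.add_mul_mul_inv_eq_sub R E Y⁻¹ Eᵀ hR.isUnit hY.inv.isUnit
    (by rw [hYY]; exact (hY.add_transpose_mul_mul hR.inv E).isUnit)
  rwa [hYY] at h

/-- Completing the square in `(b + E u)' R⁻¹ (b + E u) + u' Y u`. -/
lemma quadForm_complete_square {Y : Matrix κ κ ℝ} {R : Matrix ι ι ℝ} (hY : Y.PosDef)
    (hR : R.PosDef) (E : Matrix ι κ ℝ) (b : ι → ℝ) (u : κ → ℝ) :
    (b + E *ᵥ u) ⬝ᵥ R⁻¹ *ᵥ (b + E *ᵥ u) + u ⬝ᵥ Y *ᵥ u =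
      (u + ((Y + Eᵀ * R⁻¹ * E)⁻¹ * Eᵀ * R⁻¹) *ᵥ b) ⬝ᵥ (Y + Eᵀ * R⁻¹ * E) *ᵥ
          (u + ((Y + Eᵀ * R⁻¹ * E)⁻¹ * Eᵀ * R⁻¹) *ᵥ b) +
        b ⬝ᵥ (R + E * Y⁻¹ * Eᵀ)⁻¹ *ᵥ b := by
  have hH := hY.add_transpose_mul_mul hR.inv E
  have hHd := (isUnit_iff_isUnit_det _).1 hH.isUnit
  rw [inv_add_mul_inv_mul_transpose hY hR E, quadForm_add hR.inv.transpose_eq,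
    quadForm_add hH.transpose_eq]
  generalize hHdef : Y + Eᵀ * R⁻¹ * E = H at *
  have e1 : (E *ᵥ u) ⬝ᵥ R⁻¹ *ᵥ (E *ᵥ u) + u ⬝ᵥ Y *ᵥ u = u ⬝ᵥ H *ᵥ u := by
    rw [← hHdef, add_mulVec, dotProduct_add, add_comm, ← mulVec_mulVec, ← mulVec_mulVec,
      dotProduct_mulVec u Eᵀ, vecMul_transpose]
  have e2 : H *ᵥ ((H⁻¹ * Eᵀ * R⁻¹) *ᵥ b) = Eᵀ *ᵥ R⁻¹ *ᵥ b := by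
    rw [mulVec_mulVec, ← Matrix.mul_assoc, ← Matrix.mul_assoc, mul_nonsing_inv _ hHd,
      Matrix.one_mul, ← mulVec_mulVec]
  have e3 : ((H⁻¹ * Eᵀ * R⁻¹) *ᵥ b) ⬝ᵥ H *ᵥ u = (E *ᵥ u) ⬝ᵥ R⁻¹ *ᵥ b := by
    rw [dotProduct_mulVec_comm_of_isSymm hH.transpose_eq, e2, dotProduct_mulVec, vecMul_transpose]
  have e4 : ((H⁻¹ * Eᵀ * R⁻¹) *ᵥ b) ⬝ᵥ H *ᵥ ((H⁻¹ * Eᵀ * R⁻¹) *ᵥ b) =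
      b ⬝ᵥ (R⁻¹ * E * H⁻¹ * Eᵀ * R⁻¹) *ᵥ b := by
    rw [e2]
    have e5 : (R⁻¹ * E * H⁻¹ * Eᵀ * R⁻¹) *ᵥ b = R⁻¹ *ᵥ E *ᵥ ((H⁻¹ * Eᵀ * R⁻¹) *ᵥ b) := by
      simp only [mulVec_mulVec, Matrix.mul_assoc]
    rw [e5, dotProduct_mulVec b, ← mulVec_transpose, hR.inv.transpose_eq, dotProduct_mulVec _ E,
      ← mulVec_transpose, dotProduct_comm]
  rw [e3, e4, sub_mulVec, dotProduct_sub, ← e1]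
  ring

end QuadraticForms

-- Algebra of the Kalman update.

section PosteriorParameters

variable {ι κ : Type*} [Fintype ι] [DecidableEq ι] [Fintype κ] [DecidableEq κ]

/-- This is Woodbury with `Cᵀ` as the coupling matrix and `M⁻¹`, `W⁻¹` in the outer and inner roles.
It passes from the information form of the posterior covariance, where positivity is visible, to the
Kalman form. -/
lemma add_transpose_mul_inv_mul_inv {M : Matrix κ κ ℝ} {W : Matrix ι ι ℝ} (hM : M.PosDef)
    (hW : W.PosDef) (C : Matrix ι κ ℝ) :
    (M⁻¹ + Cᵀ * W⁻¹ * C)⁻¹ = M - M * Cᵀ * (C * M * Cᵀ + W)⁻¹ * C * M := by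
  have hMM : M⁻¹⁻¹ = M := nonsing_inv_nonsing_inv _ ((isUnit_iff_isUnit_det _).1 hM.isUnit)
  have h := inv_add_mul_inv_mul_transpose hW hM.inv Cᵀ
  simpa [hMM, add_comm W] using h

lemma posDef_posterior {M : Matrix κ κ ℝ} {W : Matrix ι ι ℝ} (hM : M.PosDef)
    (hW : W.PosDef) (C : Matrix ι κ ℝ) :
    (M - M * Cᵀ * (C * M * Cᵀ + W)⁻¹ * C * M).PosDef := by
  rw [← add_transpose_mul_inv_mul_inv hM hW C]
  exact (hM.inv.add_transpose_mul_mul hW.inv C).inv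

/-- Both sides come from the push-through identity `Cᵀ W⁻¹ (C M Cᵀ + W) = (M⁻¹ + Cᵀ W⁻¹ C) M Cᵀ` by
inverting the two positive definite factors. -/
lemma gain_eq {M : Matrix κ κ ℝ} {W : Matrix ι ι ℝ} (hM : M.PosDef)
    (hW : W.PosDef) (C : Matrix ι κ ℝ) :
    (M⁻¹ + Cᵀ * W⁻¹ * C)⁻¹ * Cᵀ * W⁻¹ = M * Cᵀ * (C * M * Cᵀ + W)⁻¹ := by
  have hHd := (isUnit_iff_isUnit_det _).1 (hM.inv.add_transpose_mul_mul hW.inv C).isUnit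
  have hG : (C * M * Cᵀ + W).PosDef := by
    rw [add_comm]; exact hM.add_mul_mul_transpose hW C
  have hGd := (isUnit_iff_isUnit_det _).1 hG.isUnit
  have hWd := (isUnit_iff_isUnit_det _).1 hW.isUnit
  have hMd := (isUnit_iff_isUnit_det _).1 hM.isUnit
  have h : Cᵀ * W⁻¹ * (C * M * Cᵀ + W) = (M⁻¹ + Cᵀ * W⁻¹ * C) * (M * Cᵀ) := by
    rw [Matrix.mul_add, Matrix.add_mul, Matrix.mul_assoc _ W⁻¹ W, nonsing_inv_mul _ hWd,
      ← Matrix.mul_assoc M⁻¹, nonsing_inv_mul _ hMd, add_comm]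
    simp [Matrix.mul_assoc]
  calc _ = (M⁻¹ + Cᵀ * W⁻¹ * C)⁻¹ * (Cᵀ * W⁻¹ * (C * M * Cᵀ + W)) * (C * M * Cᵀ + W)⁻¹ := by
        rw [Matrix.mul_assoc _ (_ * _ * _), Matrix.mul_assoc (_ * _) _ (_)⁻¹,
          mul_nonsing_inv _ hGd, Matrix.mul_one, Matrix.mul_assoc]
    _ = _ := by
        rw [h, ← Matrix.mul_assoc _ (_ + _), nonsing_inv_mul _ hHd, Matrix.one_mul]

/-- The product of a Gaussian prior weight and a Gaussian likelihood is, up to a factor that does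
not depend on the state, a Gaussian posterior weight. -/
lemma expQuad_prior_mul_likelihood {M : Matrix κ κ ℝ} {W : Matrix ι ι ℝ} (hM : M.PosDef)
    (hW : W.PosDef) (C : Matrix ι κ ℝ) (μ x : κ → ℝ) (z : ι → ℝ) :
    expQuad M⁻¹ (x - μ) * expQuad W⁻¹ (z - C *ᵥ x) =
      expQuad (C * M * Cᵀ + W)⁻¹ (z - C *ᵥ μ) *
        expQuad (M - M * Cᵀ * (C * M * Cᵀ + W)⁻¹ * C * M)⁻¹
          (x - (μ + (M * Cᵀ * (C * M * Cᵀ + W)⁻¹) *ᵥ (z - C *ᵥ μ))) := by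
  have hMM : M⁻¹⁻¹ = M := nonsing_inv_nonsing_inv _ ((isUnit_iff_isUnit_det _).1 hM.isUnit)
  have hHH := nonsing_inv_nonsing_inv _
    ((isUnit_iff_isUnit_det _).1 (hM.inv.add_transpose_mul_mul hW.inv C).isUnit)
  -- The residual is `z - C x = (z - C μ) - C (x - μ)`, so the square is completed in `x - μ` with
  -- coupling `-C`.
  have h := quadForm_complete_square hM.inv hW (-C) (z - C *ᵥ μ) (x - μ)
  have e1 : z - C *ᵥ μ + (-C) *ᵥ (x - μ) = z - C *ᵥ x := by
    rw [neg_mulVec, mulVec_sub]; abel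
  rw [e1] at h
  simp only [transpose_neg, Matrix.neg_mul, Matrix.mul_neg, neg_neg, hMM] at h
  rw [gain_eq hM hW C, neg_mulVec, add_comm W] at h
  rw [expQuad_mul_expQuad, expQuad_mul_expQuad, ← add_transpose_mul_inv_mul_inv hM hW C, hHH,
    add_comm, h, add_comm, ← sub_sub, sub_eq_add_neg (x - μ)]

end PosteriorParameters

-- Lebesgue densities of Gaussian measures.

section Density

variable {ι : Type*} [Fintype ι] [DecidableEq ι]

lemma integrable_exp_neg_half_sq_norm :
    Integrable (fun x : EuclideanSpace ℝ ι => Real.exp (-(1 / 2) * ‖x‖ ^ 2)) := by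
  have h := (GaussianFourier.integrable_cexp_neg_mul_sq_norm_add (V := EuclideanSpace ℝ ι)
    (b := 1 / 2) (by norm_num) 0 0).re
  refine h.congr (Filter.Eventually.of_forall fun x => ?_)
  simp only [zero_mul, add_zero]
  rw [show (-(1 / 2) * (‖x‖ : ℂ) ^ 2) = ((-(1 / 2) * ‖x‖ ^ 2 : ℝ) : ℂ) by push_cast; ring,
    ← Complex.ofReal_exp]
  rfl

/-- The standard Gaussian measure has a density with respect to the volume. -/
lemma exists_stdGaussian_eq_withDensity :
    ∃ c : ℝ, 0 < c ∧ stdGaussian (EuclideanSpace ℝ ι) =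
      (volume : Measure (EuclideanSpace ℝ ι)).withDensity
        fun x => ENNReal.ofReal (c * Real.exp (-(1 / 2) * ‖x‖ ^ 2)) := by
  -- The normalising constant `(2π)^(-d/2)`, in the shape produced by the Gaussian Fourier integral
  -- with `b = 1 / 2`.
  set c : ℝ := ((Real.pi / (1 / 2)) ^ (Fintype.card ι / 2 : ℝ))⁻¹ with hc
  have hc0 : 0 < c := by positivity
  refine ⟨c, hc0, ?_⟩
  have : IsFiniteMeasure ((volume : Measure (EuclideanSpace ℝ ι)).withDensity
      fun x => ENNReal.ofReal (c * Real.exp (-(1 / 2) * ‖x‖ ^ 2))) :=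
    isFiniteMeasure_withDensity_ofReal (integrable_exp_neg_half_sq_norm.const_mul c).2
  refine Measure.ext_of_charFun (funext fun t => ?_)
  rw [charFun_stdGaussian, charFun_apply, integral_withDensity_eq_integral_toReal_smul
    (by fun_prop) (by simp)]
  have h := GaussianFourier.integral_cexp_neg_mul_sq_norm_add (V := EuclideanSpace ℝ ι)
    (b := 1 / 2) (by norm_num) Complex.I t
  have hcc : ((Real.pi : ℂ) / (1 / 2)) ^ (Module.finrank ℝ (EuclideanSpace ℝ ι) / 2 : ℂ) =
      ((c⁻¹ : ℝ) : ℂ) := by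
    rw [hc, inv_inv, Complex.ofReal_cpow (by positivity)]
    simp
  have e : ∀ x : EuclideanSpace ℝ ι,
      (ENNReal.ofReal (c * Real.exp (-(1 / 2) * ‖x‖ ^ 2))).toReal • Complex.exp (⟪x, t⟫ * Complex.I)
        = (c : ℂ) * Complex.exp (-(1 / 2) * ‖x‖ ^ 2 + Complex.I * ⟪t, x⟫) := by
    intro x
    rw [ENNReal.toReal_ofReal (by positivity), Complex.real_smul, Complex.exp_add,
      real_inner_comm, mul_comm Complex.I]
    push_cast
    ring
  simp_rw [e]
  rw [integral_const_mul, h, hcc, ← mul_assoc, ← Complex.ofReal_mul, mul_inv_cancel₀ hc0.ne']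
  simp only [Complex.ofReal_one, one_mul, Complex.I_sq]
  congr 1
  ring

lemma lintegral_stdGaussian {c : ℝ} (hc : 0 < c)
    (h : stdGaussian (EuclideanSpace ℝ ι) = (volume : Measure (EuclideanSpace ℝ ι)).withDensity
        fun x => ENNReal.ofReal (c * Real.exp (-(1 / 2) * ‖x‖ ^ 2)))
    {f : EuclideanSpace ℝ ι → ℝ≥0∞} (hf : Measurable f) :
    ∫⁻ x, f x ∂stdGaussian (EuclideanSpace ℝ ι) =
      ENNReal.ofReal c * ∫⁻ x : EuclideanSpace ℝ ι, f x * expQuad 1 x.ofLp := by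
  have hm : Measurable fun x : EuclideanSpace ℝ ι => f x * expQuad 1 x.ofLp :=
    hf.mul (by fun_prop)
  rw [h, lintegral_withDensity_eq_lintegral_mul _ (by fun_prop) hf, ← lintegral_const_mul _ hm]
  refine lintegral_congr fun x => ?_
  rw [Pi.mul_apply, ENNReal.ofReal_mul hc.le, expQuad, one_mulVec, EuclideanSpace.real_norm_sq_eq]
  simp only [dotProduct, ← pow_two]
  ring

/-- Moves the mean out of the measure and into the integrand, where joint measurability in the mean
can be checked. -/
lemma multivariateGaussian_eq_map_add (μ : EuclideanSpace ℝ ι) (S : Matrix ι ι ℝ) :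
    multivariateGaussian μ S = (multivariateGaussian 0 S).map (fun x => μ + x) := by
  unfold multivariateGaussian
  rw [Measure.map_map (by fun_prop) (by fun_prop)]
  simp [Function.comp_def]

/-- A nondegenerate Gaussian measure has a Gaussian density; the normalising factor depends on the
covariance matrix only. -/
lemma exists_lintegral_multivariateGaussian {S : Matrix ι ι ℝ} (hS : S.PosDef) :
    ∃ a : ℝ≥0∞, a ≠ 0 ∧ a ≠ ∞ ∧ ∀ (μ : EuclideanSpace ℝ ι) (f : EuclideanSpace ℝ ι → ℝ≥0∞),
      Measurable f → ∫⁻ x, f x ∂multivariateGaussian μ S =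
        a * ∫⁻ x : ι → ℝ, f (WithLp.toLp 2 x) * expQuad S⁻¹ (x - μ.ofLp) := by
  obtain ⟨c, hc, h⟩ := exists_stdGaussian_eq_withDensity (ι := ι)
  unfold multivariateGaussian
  set T : Matrix ι ι ℝ := CFC.sqrt S with hT
  have hTT : T * T = S := CFC.sqrt_mul_sqrt_self _ hS.posSemidef.nonneg
  have hTs : Tᵀ = T := by
    have := (CFC.sqrt_nonneg S).isSelfAdjoint
    rwa [IsSelfAdjoint, star_eq_conjTranspose, conjTranspose_eq_transpose_of_trivial] at this
  have hdet : T.det ≠ 0 := by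
    intro h0
    have := hS.det_pos
    rw [← hTT, det_mul, h0] at this
    simp at this
  have hTu : IsUnit T.det := hdet.isUnit
  -- Under the substitution `x ↦ T x` with `T` the square root of `S`, this turns the standard
  -- weight into the weight of `S⁻¹`.
  have hTST : T * S⁻¹ * T = 1 := by
    rw [← hTT, Matrix.mul_inv_rev, ← Matrix.mul_assoc, mul_nonsing_inv _ hTu, Matrix.one_mul,
      nonsing_inv_mul _ hTu]
  have hLdet : LinearMap.det (T.toEuclideanLin) ≠ 0 := by
    rwa [LinearMap.det_toLpLin]
  -- The standard normalising constant times the Jacobian factor of `T`; the mean enters only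
  -- through a translation and leaves no trace here.
  refine ⟨ENNReal.ofReal c * ENNReal.ofReal |(LinearMap.det (T.toEuclideanLin))⁻¹|,
    by
      simp only [ne_eq, mul_eq_zero, ENNReal.ofReal_eq_zero, not_or, not_le]
      exact ⟨hc, abs_pos.2 (inv_ne_zero hLdet)⟩, by finiteness, fun μ f hf => ?_⟩
  have hm : Measurable fun x : EuclideanSpace ℝ ι => f (μ + x) * expQuad S⁻¹ x.ofLp :=
    (hf.comp (by fun_prop)).mul (by fun_prop)
  have hL : Measurable (T.toEuclideanLin) :=
    (T.toEuclideanLin).continuous_of_finiteDimensional.measurable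
  rw [lintegral_map hf (by fun_prop), lintegral_stdGaussian hc h
    (f := fun x => f (μ + (toEuclideanCLM (𝕜 := ℝ) T) x)) (hf.comp (by fun_prop)), mul_assoc]
  congr 1
  have e : ∀ x : EuclideanSpace ℝ ι,
      f (μ + (toEuclideanCLM (𝕜 := ℝ) T) x) * expQuad 1 x.ofLp =
        (fun x : EuclideanSpace ℝ ι => f (μ + x) * expQuad S⁻¹ x.ofLp) (T.toEuclideanLin x) := by
    intro x
    have e1 : (T.toEuclideanLin x).ofLp = T *ᵥ x.ofLp := rfl
    have e2 : (toEuclideanCLM (𝕜 := ℝ) T) x = T.toEuclideanLin x := rfl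
    simp only [e2, e1, expQuad]
    rw [← hTST, ← mulVec_mulVec, ← mulVec_mulVec, dotProduct_mulVec _ T, ← mulVec_transpose, hTs]
  simp_rw [e]
  rw [← lintegral_map hm hL, Measure.map_linearMap_addHaar_eq_smul_addHaar _ hLdet,
    lintegral_smul_measure, smul_eq_mul]
  congr 1
  rw [← (PiLp.volume_preserving_toLp ι).lintegral_comp hm,
    ← lintegral_sub_right_eq_self _ μ.ofLp]
  refine lintegral_congr fun x => ?_
  congr 2
  ext i
  simp

end Density

-- Bayes' rule when some coordinates are seen and the others carry a Gaussian weight.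

section PartialObservation

variable {ι κ : Type*} [Fintype ι] [DecidableEq ι] [Fintype κ] [DecidableEq κ]
  (p : ι → Prop) [DecidablePred p]

/-- Replace the coordinates outside of `p` by zero. -/
def zeroFill (y : ι → ℝ) : ι → ℝ := fun i => if p i then y i else 0

/-- Extend a vector of the coordinates in `p` by zero. -/
def zeroExtend (y : {i // p i} → ℝ) : ι → ℝ := fun i => if h : p i then y ⟨i, h⟩ else 0

/-- The diagonal projection onto the coordinates outside of `p`. -/
def dropDiag : Matrix ι ι ℝ := diagonal fun i => if p i then 0 else 1

/-- The diagonal block of the coordinates outside of `p`. -/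
def dropBlock (Y : Matrix ι ι ℝ) : Matrix {i // ¬ p i} {i // ¬ p i} ℝ :=
  Y.submatrix Subtype.val Subtype.val

lemma posDef_dropBlock {Y : Matrix ι ι ℝ} (hY : Y.PosDef) : (dropBlock p Y).PosDef :=
  hY.submatrix Subtype.val_injective

/-- The inclusion of the coordinates outside of `p`. -/
def dropIncl : Matrix ι {i // ¬ p i} ℝ := (1 : Matrix ι ι ℝ).submatrix id Subtype.val

@[fun_prop]
lemma measurable_zeroFill : Measurable (zeroFill p) := by
  refine measurable_pi_lambda _ fun i => ?_
  unfold zeroFill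
  split_ifs <;> fun_prop

@[fun_prop]
lemma measurable_zeroExtend : Measurable (zeroExtend p) := by
  refine measurable_pi_lambda _ fun i => ?_
  unfold zeroExtend
  split_ifs <;> fun_prop

lemma zeroFill_zeroExtend (y : {i // p i} → ℝ) : zeroFill p (zeroExtend p y) = zeroExtend p y := by
  ext i
  by_cases h : p i <;> simp [zeroFill, zeroExtend, h]

lemma zeroFill_zeroFill (y : ι → ℝ) : zeroFill p (zeroFill p y) = zeroFill p y := by
  ext i
  by_cases h : p i <;> simp [zeroFill, h]

lemma dropIncl_mulVec (u : {i // ¬ p i} → ℝ) (i : ι) :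
    (dropIncl p *ᵥ u) i = if h : p i then 0 else u ⟨i, h⟩ := by
  simp only [dropIncl, mulVec, dotProduct, submatrix_apply, id_eq, one_apply, ite_mul, one_mul,
    zero_mul]
  split_ifs with h
  · refine Finset.sum_eq_zero fun j _ => if_neg ?_
    rintro rfl
    exact j.2 h
  · rw [Finset.sum_eq_single ⟨i, h⟩] <;> simp +contextual [Subtype.ext_iff, eq_comm]

lemma dropIncl_mul_transpose : dropIncl p * (dropIncl p)ᵀ = dropDiag p := by
  ext i j
  have h := dropIncl_mulVec p (fun k => dropIncl p j k) i
  rw [Matrix.mul_apply]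
  simp only [mulVec, dotProduct] at h
  simp only [transpose_apply]
  rw [h]
  simp only [dropDiag, diagonal_apply, dropIncl, submatrix_apply, id_eq, one_apply]
  by_cases hi : p i <;> simp [hi, eq_comm]

lemma piEquivPiSubtypeProd_symm_eq (y : {i // p i} → ℝ) (u : {i // ¬ p i} → ℝ) :
    (MeasurableEquiv.piEquivPiSubtypeProd (fun _ : ι => ℝ) p).symm (y, u) =
      zeroExtend p y + dropIncl p *ᵥ u := by
  ext i
  rw [Pi.add_apply, dropIncl_mulVec]
  change (if h : p i then y ⟨i, h⟩ else u ⟨i, h⟩) = _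
  by_cases h : p i <;> simp [zeroExtend, h]

lemma zeroFill_add (y : {i // p i} → ℝ) (u : {i // ¬ p i} → ℝ) :
    zeroFill p (zeroExtend p y + dropIncl p *ᵥ u) = zeroExtend p y := by
  ext i
  rw [zeroFill, Pi.add_apply, dropIncl_mulVec]
  by_cases h : p i <;> simp [zeroExtend, h]

lemma quadForm_dropIncl (Y : Matrix ι ι ℝ) (u : {i // ¬ p i} → ℝ) :
    (dropIncl p *ᵥ u) ⬝ᵥ Y *ᵥ (dropIncl p *ᵥ u) =
      u ⬝ᵥ (dropBlock p Y) *ᵥ u := by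
  have h : dropBlock p Y = (dropIncl p)ᵀ * Y * dropIncl p := by
    ext i j
    simp [dropBlock, dropIncl, Matrix.mul_apply, one_apply]
  rw [h, ← mulVec_mulVec, ← mulVec_mulVec, dotProduct_mulVec u, vecMul_transpose]

/-- By `hYp` and symmetry, `Y` has no entries between the two groups of coordinates, so it preserves
the unseen subspace and commutes with `dropDiag p`. Hence inverting the unseen block agrees with
taking that block of `Y⁻¹`; after left multiplication by `Y` both sides are `dropDiag p`. -/
lemma dropIncl_mul_inv_mul_transpose {Y : Matrix ι ι ℝ} (hY : Y.PosDef)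
    (hYp : ∀ i j, p i → ¬ p j → Y i j = 0) :
    dropIncl p * (dropBlock p Y)⁻¹ * (dropIncl p)ᵀ =
      dropDiag p * Y⁻¹ := by
  have hYn : (dropBlock p Y).PosDef :=
    posDef_dropBlock p hY
  have hd := (isUnit_iff_isUnit_det _).1 hYn.isUnit
  have hYd := (isUnit_iff_isUnit_det _).1 hY.isUnit
  have hYp' : ∀ i j, ¬ p i → p j → Y i j = 0 := fun i j hi hj => by
    rw [← hY.transpose_eq]; exact hYp j i hj hi
  have e1 : Y * dropIncl p = dropIncl p * dropBlock p Y := by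
    ext i j
    have h := dropIncl_mulVec p (fun k => Y k j) i
    simp only [mulVec, dotProduct] at h
    rw [Matrix.mul_apply, Matrix.mul_apply]
    simp only [dropBlock, submatrix_apply]
    rw [h]
    simp only [dropIncl, submatrix_apply, id_eq, one_apply, mul_ite, mul_one, mul_zero,
      Finset.sum_ite_eq', Finset.mem_univ, if_true]
    split_ifs with hi
    · exact hYp _ _ hi j.2
    · rfl
  have e2 : Y * dropDiag p = dropDiag p * Y := by
    ext i j
    rw [dropDiag, mul_diagonal, diagonal_mul]
    by_cases hi : p i <;> by_cases hj : p j <;> simp [hi, hj, hYp, hYp']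
  have key : Y * (dropIncl p * (dropBlock p Y)⁻¹ *
      (dropIncl p)ᵀ) = Y * (dropDiag p * Y⁻¹) := by
    rw [← Matrix.mul_assoc, ← Matrix.mul_assoc, e1, Matrix.mul_assoc (dropIncl p),
      mul_nonsing_inv _ hd, Matrix.mul_one, dropIncl_mul_transpose, ← Matrix.mul_assoc, e2,
      Matrix.mul_assoc, mul_nonsing_inv _ hYd, Matrix.mul_one]
  have := congrArg (Y⁻¹ * ·) key
  simpa only [← Matrix.mul_assoc Y⁻¹ Y, nonsing_inv_mul _ hYd, Matrix.one_mul] using this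

lemma posDef_add_dropDiag_mul_inv {R Y : Matrix ι ι ℝ} (hR : R.PosDef) (hY : Y.PosDef)
    (hYp : ∀ i j, p i → ¬ p j → Y i j = 0) : (R + dropDiag p * Y⁻¹).PosDef := by
  rw [← dropIncl_mul_inv_mul_transpose p hY hYp]
  exact (posDef_dropBlock p hY).inv.add_mul_mul_transpose hR _

/-- Integrating out the coordinates outside of `p`, with a Gaussian weight, increases the
covariance of a Gaussian likelihood. -/
lemma exists_lintegral_expQuad_drop {R Y : Matrix ι ι ℝ} (hR : R.PosDef) (hY : Y.PosDef)
    (hYp : ∀ i j, p i → ¬ p j → Y i j = 0) :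
    ∃ K : ℝ≥0∞, ∀ (c : ι → ℝ) (φ : (ι → ℝ) → ℝ≥0∞), Measurable φ →
      (∀ y, φ (zeroFill p y) = φ y) →
      ∫⁻ y, φ y * expQuad Y (y - zeroFill p y) * expQuad R⁻¹ (y - c) =
        K * ∫⁻ y : {i // p i} → ℝ, φ (zeroExtend p y) *
          expQuad (R + dropDiag p * Y⁻¹)⁻¹ (zeroExtend p y - c) := by
  have hYn : (dropBlock p Y).PosDef := posDef_dropBlock p hY
  set H := dropBlock p Y + (dropIncl p)ᵀ * R⁻¹ * dropIncl p
  -- After completing the square, the unseen coordinates appear only in a shifted Gaussian weight.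
  -- By translation invariance its integral depends neither on `c` nor on the seen coordinates.
  refine ⟨∫⁻ u, expQuad H u, fun c φ hφ hφp => ?_⟩
  have hm : Measurable fun y => φ y * expQuad Y (y - zeroFill p y) * expQuad R⁻¹ (y - c) := by
    fun_prop
  have hm2 : Measurable fun y : {i // p i} → ℝ => φ (zeroExtend p y) *
          expQuad (R + dropDiag p * Y⁻¹)⁻¹ (zeroExtend p y - c) := by
    fun_prop
  rw [← ((volume_preserving_piEquivPiSubtypeProd (fun _ : ι => ℝ) p).symm).lintegral_comp hm,
    Measure.volume_eq_prod, lintegral_prod _ (by fun_prop), ← lintegral_const_mul _ hm2]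
  refine lintegral_congr fun y => ?_
  have e : ∀ u : {i // ¬ p i} → ℝ,
      φ ((MeasurableEquiv.piEquivPiSubtypeProd (fun _ : ι => ℝ) p).symm (y, u)) *
        expQuad Y ((MeasurableEquiv.piEquivPiSubtypeProd (fun _ : ι => ℝ) p).symm (y, u) -
          zeroFill p ((MeasurableEquiv.piEquivPiSubtypeProd (fun _ : ι => ℝ) p).symm (y, u))) *
        expQuad R⁻¹ ((MeasurableEquiv.piEquivPiSubtypeProd (fun _ : ι => ℝ) p).symm (y, u) - c) =
      (φ (zeroExtend p y) * expQuad (R + dropDiag p * Y⁻¹)⁻¹ (zeroExtend p y - c)) *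
        expQuad H (u + (H⁻¹ * (dropIncl p)ᵀ * R⁻¹) *ᵥ (zeroExtend p y - c)) := by
    intro u
    rw [piEquivPiSubtypeProd_symm_eq, zeroFill_add, ← hφp, zeroFill_add, add_sub_cancel_left,
      mul_assoc, mul_assoc, expQuad_mul_expQuad, expQuad_mul_expQuad, quadForm_dropIncl,
      add_sub_right_comm, add_comm, quadForm_complete_square hYn hR,
      dropIncl_mul_inv_mul_transpose p hY hYp, add_comm]
  simp_rw [e]
  rw [lintegral_const_mul _ (by fun_prop), lintegral_add_right_eq_self (expQuad H), mul_comm]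

/-- The posterior covariance for a Gaussian prior covariance `M` and a linear measurement. -/
noncomputable def posteriorCov (M : Matrix κ κ ℝ) (C : Matrix ι κ ℝ) (W : Matrix ι ι ℝ) :
    Matrix κ κ ℝ :=
  M - M * Cᵀ * (C * M * Cᵀ + W)⁻¹ * C * M

/-- The posterior mean for a Gaussian prior and a linear measurement. -/
noncomputable def posteriorMean (M : Matrix κ κ ℝ) (C : Matrix ι κ ℝ) (W : Matrix ι ι ℝ)
    (μ : EuclideanSpace ℝ κ) (z : ι → ℝ) : EuclideanSpace ℝ κ :=
  μ + WithLp.toLp 2 ((M * Cᵀ * (C * M * Cᵀ + W)⁻¹) *ᵥ (z - C *ᵥ μ.ofLp))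

@[fun_prop]
lemma Measurable.posteriorMean {α : Type*} [MeasurableSpace α] (M : Matrix κ κ ℝ)
    (C : Matrix ι κ ℝ) (W : Matrix ι ι ℝ) {μ : α → EuclideanSpace ℝ κ} {z : α → ι → ℝ}
    (hμ : Measurable μ) (hz : Measurable z) :
    Measurable fun a => posteriorMean M C W (μ a) (z a) := by
  unfold _root_.posteriorMean
  have h : Continuous fun q : EuclideanSpace ℝ κ × (ι → ℝ) =>
      q.1 + WithLp.toLp 2 ((M * Cᵀ * (C * M * Cᵀ + W)⁻¹) *ᵥ (q.2 - C *ᵥ q.1.ofLp)) := by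
    fun_prop
  exact h.measurable.comp (hμ.prodMk hz)

lemma measurable_lintegral_multivariateGaussian {α : Type*} [MeasurableSpace α]
    (S : Matrix κ κ ℝ) {μ : α → EuclideanSpace ℝ κ} (hμ : Measurable μ)
    {h : EuclideanSpace ℝ κ → ℝ≥0∞} (hh : Measurable h) :
    Measurable fun a => ∫⁻ x, h x ∂multivariateGaussian (μ a) S := by
  have e : ∀ a, ∫⁻ x, h x ∂multivariateGaussian (μ a) S =
      ∫⁻ x, h (μ a + x) ∂multivariateGaussian 0 S := fun a => by
    rw [multivariateGaussian_eq_map_add, lintegral_map hh (by fun_prop)]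
  simp_rw [e]
  exact Measurable.lintegral_prod_right' (f := fun q : α × EuclideanSpace ℝ κ => h (μ q.1 + q.2))
    (by fun_prop)

/-- What matters is that `a` is the same for all `φ` and `h`: two instances can then be compared
without computing `a`. The unseen coordinates are integrated out for fixed state, the prior and the
likelihood are refactored by `expQuad_prior_mul_likelihood`, and Tonelli brings the state integral
inside. -/
lemma exists_lintegral_gaussian_partial_observation {M : Matrix κ κ ℝ} {R Y : Matrix ι ι ℝ}
    (hM : M.PosDef) (hR : R.PosDef) (hY : Y.PosDef) (hYp : ∀ i j, p i → ¬ p j → Y i j = 0)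
    (C : Matrix ι κ ℝ) (μ : EuclideanSpace ℝ κ) :
    ∃ a : ℝ≥0∞, ∀ (φ : (ι → ℝ) → ℝ≥0∞) (h : EuclideanSpace ℝ κ → ℝ≥0∞), Measurable φ →
      Measurable h → (∀ y, φ (zeroFill p y) = φ y) →
      ∫⁻ x, ∫⁻ v, φ (C *ᵥ x.ofLp + v.ofLp) *
          expQuad Y (C *ᵥ x.ofLp + v.ofLp - zeroFill p (C *ᵥ x.ofLp + v.ofLp)) * h x
          ∂multivariateGaussian 0 R ∂multivariateGaussian μ M =
        a * ∫⁻ y : {i // p i} → ℝ, φ (zeroExtend p y) *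
          expQuad (C * M * Cᵀ + (R + dropDiag p * Y⁻¹))⁻¹ (zeroExtend p y - C *ᵥ μ.ofLp) *
          ∫⁻ x, h x ∂multivariateGaussian
            (posteriorMean M C (R + dropDiag p * Y⁻¹) μ (zeroExtend p y))
            (posteriorCov M C (R + dropDiag p * Y⁻¹)) := by
  set W := R + dropDiag p * Y⁻¹ with hWdef
  have hW : W.PosDef := posDef_add_dropDiag_mul_inv p hR hY hYp
  have hS : (posteriorCov M C W).PosDef := posDef_posterior hM hW C
  obtain ⟨aR, -, -, hRint⟩ := exists_lintegral_multivariateGaussian hR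
  obtain ⟨aM, -, -, hMint⟩ := exists_lintegral_multivariateGaussian hM
  obtain ⟨aS, hS0, hSt, hSint⟩ := exists_lintegral_multivariateGaussian hS
  obtain ⟨K, hK⟩ := exists_lintegral_expQuad_drop p hR hY hYp
  -- `aM` and `aR` normalise the prior and the noise, `K` comes from the unseen coordinates, and
  -- `aS⁻¹` converts the posterior weight back to a probability measure. The last is why `aS` must
  -- be nonzero and finite.
  refine ⟨aM * (aR * K) * aS⁻¹, fun φ h hφ hh hφp => ?_⟩
  have hC : Continuous fun x : EuclideanSpace ℝ κ => C *ᵥ x.ofLp := by fun_prop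
  have hCm := hC.measurable
  have hC' : Continuous fun x : κ → ℝ => C *ᵥ x := by fun_prop
  have hCm' := hC'.measurable
  have inner : ∀ x : EuclideanSpace ℝ κ,
      ∫⁻ v, φ (C *ᵥ x.ofLp + v.ofLp) *
          expQuad Y (C *ᵥ x.ofLp + v.ofLp - zeroFill p (C *ᵥ x.ofLp + v.ofLp)) * h x
          ∂multivariateGaussian 0 R =
        aR * K * ((∫⁻ y : {i // p i} → ℝ, φ (zeroExtend p y) *
          expQuad W⁻¹ (zeroExtend p y - C *ᵥ x.ofLp)) * h x) := by
    intro x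
    have e : ∀ v : ι → ℝ, φ (C *ᵥ x.ofLp + v) *
          expQuad Y (C *ᵥ x.ofLp + v - zeroFill p (C *ᵥ x.ofLp + v)) * expQuad R⁻¹ (v - 0) =
        (fun y => φ y * expQuad Y (y - zeroFill p y) * expQuad R⁻¹ (y - C *ᵥ x.ofLp))
          (C *ᵥ x.ofLp + v) := by
      intro v
      simp
    rw [lintegral_mul_const _ (by fun_prop), hRint 0 _ (by fun_prop)]
    simp only [WithLp.ofLp_zero]
    simp_rw [e]
    rw [lintegral_add_left_eq_self
      (fun y => φ y * expQuad Y (y - zeroFill p y) * expQuad R⁻¹ (y - C *ᵥ x.ofLp)),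
      hK _ φ hφ hφp]
    ring
  have post : ∀ m : EuclideanSpace ℝ κ,
      ∫⁻ x : κ → ℝ, h (WithLp.toLp 2 x) * expQuad (posteriorCov M C W)⁻¹ (x - m.ofLp) =
        aS⁻¹ * ∫⁻ x, h x ∂multivariateGaussian m (posteriorCov M C W) := by
    intro m
    rw [hSint m h hh, ← mul_assoc, ENNReal.inv_mul_cancel hS0 hSt, one_mul]
  have hG : Measurable fun x : EuclideanSpace ℝ κ => ∫⁻ y : {i // p i} → ℝ, φ (zeroExtend p y) *
          expQuad W⁻¹ (zeroExtend p y - C *ᵥ x.ofLp) :=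
    Measurable.lintegral_prod_right' (f := fun q : EuclideanSpace ℝ κ × ({i // p i} → ℝ) =>
      φ (zeroExtend p q.2) * expQuad W⁻¹ (zeroExtend p q.2 - C *ᵥ q.1.ofLp)) (by fun_prop)
  simp_rw [inner]
  have hGh := hG.mul hh
  simp only [Pi.mul_def] at hGh
  rw [lintegral_const_mul _ hGh, hMint μ _ hGh]
  have e2 : ∀ x : κ → ℝ,
      (∫⁻ y : {i // p i} → ℝ, φ (zeroExtend p y) * expQuad W⁻¹ (zeroExtend p y - C *ᵥ x)) *
        h (WithLp.toLp 2 x) * expQuad M⁻¹ (x - μ.ofLp) =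
      ∫⁻ y : {i // p i} → ℝ, φ (zeroExtend p y) *
        expQuad (C * M * Cᵀ + W)⁻¹ (zeroExtend p y - C *ᵥ μ.ofLp) *
        (h (WithLp.toLp 2 x) * expQuad (posteriorCov M C W)⁻¹
          (x - (posteriorMean M C W μ (zeroExtend p y)).ofLp)) := by
    intro x
    rw [mul_assoc, ← lintegral_mul_const _ (by fun_prop)]
    refine lintegral_congr fun y => ?_
    have e3 := expQuad_prior_mul_likelihood hM hW C μ.ofLp x (zeroExtend p y)
    calc _ = φ (zeroExtend p y) * h (WithLp.toLp 2 x) * (expQuad M⁻¹ (x - μ.ofLp) *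
          expQuad W⁻¹ (zeroExtend p y - C *ᵥ x)) := by ring
      _ = _ := by
        rw [e3]
        simp only [posteriorCov, posteriorMean, WithLp.ofLp_add]
        ring
  simp_rw [e2]
  rw [lintegral_lintegral_swap (by fun_prop)]
  have e4 : ∀ y : {i // p i} → ℝ, ∫⁻ x : κ → ℝ, φ (zeroExtend p y) *
        expQuad (C * M * Cᵀ + W)⁻¹ (zeroExtend p y - C *ᵥ μ.ofLp) *
        (h (WithLp.toLp 2 x) * expQuad (posteriorCov M C W)⁻¹
          (x - (posteriorMean M C W μ (zeroExtend p y)).ofLp)) =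
      aS⁻¹ * (φ (zeroExtend p y) *
          expQuad (C * M * Cᵀ + W)⁻¹ (zeroExtend p y - C *ᵥ μ.ofLp) *
          ∫⁻ x, h x ∂multivariateGaussian (posteriorMean M C W μ (zeroExtend p y))
            (posteriorCov M C W)) := by
    intro y
    rw [lintegral_const_mul _ (by fun_prop), post]
    ring
  simp_rw [e4]
  have hpm := measurable_lintegral_multivariateGaussian (posteriorCov M C W)
    (Measurable.posteriorMean M C W (measurable_const (a := μ)) (measurable_zeroExtend p)) hh
  rw [lintegral_const_mul _ (by fun_prop)]
  ring

/-- The measurement update for a Gaussian prior: if the coordinates in `p` of the measurement are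
observed, and a Gaussian function of the other coordinates is used as a weight, then the
conditional law of the state is Gaussian. -/
lemma lintegral_gaussian_partial_observation {M : Matrix κ κ ℝ} {R Y : Matrix ι ι ℝ}
    (hM : M.PosDef) (hR : R.PosDef) (hY : Y.PosDef) (hYp : ∀ i j, p i → ¬ p j → Y i j = 0)
    (C : Matrix ι κ ℝ) (μ : EuclideanSpace ℝ κ) {φ : (ι → ℝ) → ℝ≥0∞}
    {h : EuclideanSpace ℝ κ → ℝ≥0∞} (hφ : Measurable φ) (hh : Measurable h)
    (hφp : ∀ y, φ (zeroFill p y) = φ y) :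
    ∫⁻ x, ∫⁻ v, φ (C *ᵥ x.ofLp + v.ofLp) *
        expQuad Y (C *ᵥ x.ofLp + v.ofLp - zeroFill p (C *ᵥ x.ofLp + v.ofLp)) * h x
        ∂multivariateGaussian 0 R ∂multivariateGaussian μ M =
      ∫⁻ x, ∫⁻ v, φ (C *ᵥ x.ofLp + v.ofLp) *
        expQuad Y (C *ᵥ x.ofLp + v.ofLp - zeroFill p (C *ᵥ x.ofLp + v.ofLp)) *
        (∫⁻ x', h x' ∂multivariateGaussian
            (posteriorMean M C (R + dropDiag p * Y⁻¹) μ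
              (zeroFill p (C *ᵥ x.ofLp + v.ofLp)))
            (posteriorCov M C (R + dropDiag p * Y⁻¹)))
        ∂multivariateGaussian 0 R ∂multivariateGaussian μ M := by
  obtain ⟨a, ha⟩ := exists_lintegral_gaussian_partial_observation p hM hR hY hYp C μ
  have hpm := measurable_lintegral_multivariateGaussian
    (posteriorCov M C (R + dropDiag p * Y⁻¹))
    (Measurable.posteriorMean M C (R + dropDiag p * Y⁻¹) (measurable_const (a := μ))
      (measurable_zeroFill p)) hh
  -- The second instance absorbs the posterior integral into the test function, which is allowed
  -- because that integral sees only the zero-filled measurement, and takes `h = 1`. Both instances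
  -- have the same right-hand side.
  have h2 := ha (fun y => φ y * ∫⁻ x', h x' ∂multivariateGaussian
      (posteriorMean M C (R + dropDiag p * Y⁻¹) μ (zeroFill p y))
      (posteriorCov M C (R + dropDiag p * Y⁻¹))) (fun _ => 1) (hφ.mul hpm) measurable_const
      (fun y => by rw [hφp, zeroFill_zeroFill])
  rw [ha φ h hφ hh hφp]
  simp only [zeroFill_zeroExtend, lintegral_one, measure_univ, mul_one] at h2
  refine Eq.trans ?_ (h2.symm.trans ?_)
  · congr 1
    refine lintegral_congr fun y => ?_
    ring
  · refine lintegral_congr fun x => lintegral_congr fun v => ?_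
    ring

end PartialObservation

-- Packets, the random trigger and the static measurement update.

namespace EventEstimation

variable {n m : ℕ} {s : Fin m → ℕ}

/-- The part of a stacked measurement vector that belongs to sensor `i`. -/
def sensorBlock (i : Fin m) (y : MeasIdx s → ℝ) : EuclideanSpace ℝ (Fin (s i)) :=
  WithLp.toLp 2 fun j => y ⟨i, j⟩

/-- The packet with given decisions and a given measurement vector. -/
def packOf (g : Fin m → Bool) (y : MeasIdx s → ℝ) : Packet s :=
  ⟨g, fun i => sensorBlock i y⟩

/-- The decisions, as a function of the measurement vector and of the randomizing variables. -/
noncomputable def decisionFun (S : SensorSystem n m s) (y : MeasIdx s → ℝ) (z : Fin m → ℝ) :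
    Fin m → Bool :=
  fun i => decide (dropProb S i (sensorBlock i y) < z i)

/-- The packet, as a function of the measurement vector and of the randomizing variables. -/
noncomputable def packetFun (S : SensorSystem n m s) (y : MeasIdx s → ℝ) (z : Fin m → ℝ) :
    Packet s :=
  packOf (decisionFun S y z) y

/-- The measurement vector in a packet, with zeros at the places that were not transmitted. -/
def Packet.fill (p : Packet s) : MeasIdx s → ℝ :=
  fun q => if h : p.1 q.1 = true then p.2 ⟨q.1, h⟩ q.2 else 0

/-- The coordinates of the sensors that transmit. -/
abbrev Transmitted (g : Fin m → Bool) (q : MeasIdx s) : Prop := g q.1 = true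

lemma fill_packOf (g : Fin m → Bool) (y : MeasIdx s → ℝ) :
    Packet.fill (packOf g y) = zeroFill (Transmitted g) y := by
  ext q
  simp [Packet.fill, packOf, zeroFill, sensorBlock]

lemma packOf_zeroFill (g : Fin m → Bool) (y : MeasIdx s → ℝ) :
    packOf g (zeroFill (Transmitted g) y) = packOf g y := by
  unfold packOf
  congr 1
  ext i j
  simp [sensorBlock, zeroFill, i.2]

section

variable {Ω : Type*} [MeasurableSpace Ω]

lemma decision_eq (S : SensorSystem n m s) (I : RandomInputs Ω n m s) (k : ℕ) (ω : Ω) :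
    decision S I k ω = decisionFun S (stackedMeas S I k ω).ofLp (fun i => I.ζ k i ω) := rfl

lemma packet_eq (S : SensorSystem n m s) (I : RandomInputs Ω n m s) (k : ℕ) (ω : Ω) :
    packet S I k ω = packetFun S (stackedMeas S I k ω).ofLp (fun i => I.ζ k i ω) := rfl

lemma stackedMeas_eq (S : SensorSystem n m s) (I : RandomInputs Ω n m s) (k : ℕ) (ω : Ω) :
    (stackedMeas S I k ω).ofLp = S.stackedC *ᵥ (state S I k ω).ofLp + (I.v k ω).ofLp := rfl

end

@[fun_prop]
lemma measurable_sensorBlock (i : Fin m) :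
    Measurable (sensorBlock i : (MeasIdx s → ℝ) → EuclideanSpace ℝ (Fin (s i))) := by
  unfold sensorBlock
  fun_prop

lemma measurable_sigma_mk {α : Type*} {β : α → Type*} [∀ a, MeasurableSpace (β a)] (a : α) :
    Measurable (Sigma.mk a : β a → Sigma β) :=
  fun _ hs => MeasurableSpace.measurableSet_iInf.1 hs a

lemma measurable_of_sigma {α γ : Type*} {β : α → Type*} [∀ a, MeasurableSpace (β a)]
    [MeasurableSpace γ] {f : Sigma β → γ} (hf : ∀ a, Measurable fun b => f ⟨a, b⟩) :
    Measurable f :=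
  fun _ ht => MeasurableSpace.measurableSet_iInf.2 fun a => hf a ht

lemma measurable_packOf (g : Fin m → Bool) :
    Measurable (packOf g : (MeasIdx s → ℝ) → Packet s) := by
  unfold packOf
  exact (measurable_sigma_mk g).comp (measurable_pi_lambda _ fun i => measurable_sensorBlock _)

lemma measurable_packet_fst : Measurable (Sigma.fst : Packet s → Fin m → Bool) :=
  measurable_of_sigma fun _ => measurable_const

lemma measurable_fill : Measurable (Packet.fill : Packet s → MeasIdx s → ℝ) := by
  refine measurable_of_sigma fun g => measurable_pi_lambda _ fun q => ?_
  unfold Packet.fill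
  by_cases h : g q.1 = true
  · have e : ∀ b : ((i : {i : Fin m // g i = true}) → EuclideanSpace ℝ (Fin (s i))),
        (if h : g q.1 = true then b ⟨q.1, h⟩ q.2 else 0) = b ⟨q.1, h⟩ q.2 := fun b => dif_pos h
    simp_rw [e]
    have h1 : Measurable fun x : EuclideanSpace ℝ (Fin (s q.1)) => x q.2 := by fun_prop
    exact h1.comp (measurable_pi_apply (⟨q.1, h⟩ : {i : Fin m // g i = true}))
  · have e : ∀ b : ((i : {i : Fin m // g i = true}) → EuclideanSpace ℝ (Fin (s i))),
        (if h : g q.1 = true then b ⟨q.1, h⟩ q.2 else 0) = 0 := fun b => dif_neg h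
    simp_rw [e]
    exact measurable_const

lemma continuous_dropProb (S : SensorSystem n m s) (i : Fin m) : Continuous (dropProb S i) := by
  unfold dropProb
  fun_prop

@[fun_prop]
lemma measurable_dropProb (S : SensorSystem n m s) (i : Fin m) : Measurable (dropProb S i) :=
  (continuous_dropProb S i).measurable

lemma measurable_decisionFun (S : SensorSystem n m s) :
    Measurable fun q : (MeasIdx s → ℝ) × (Fin m → ℝ) => decisionFun S q.1 q.2 := by
  refine measurable_pi_lambda _ fun i => measurable_to_bool ?_
  have : (fun q : (MeasIdx s → ℝ) × (Fin m → ℝ) => decisionFun S q.1 q.2 i) ⁻¹' {true} =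
      {q | dropProb S i (sensorBlock i q.1) < q.2 i} := by
    ext q; simp [decisionFun]
  rw [this]
  exact measurableSet_lt (by fun_prop) (by fun_prop)

lemma measurable_packetFun (S : SensorSystem n m s) :
    Measurable fun q : (MeasIdx s → ℝ) × (Fin m → ℝ) => packetFun S q.1 q.2 := by
  -- There are finitely many decision patterns, so measurability may be checked for each fixed
  -- pattern.
  have h : Measurable fun q : (Fin m → Bool) × (MeasIdx s → ℝ) => packOf q.1 q.2 :=
    measurable_from_prod_countable_right fun g => measurable_packOf g
  exact h.comp ((measurable_decisionFun S).prodMk measurable_fst)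

/-- The uniform distribution on the unit interval. -/
noncomputable def unitUniform : Measure ℝ := ProbabilityTheory.cond volume (Set.Icc 0 1)

instance : IsProbabilityMeasure unitUniform :=
  ProbabilityTheory.cond_isProbabilityMeasure_of_finite (by simp) (by simp)

lemma unitUniform_Iic {d : ℝ} (h1 : d ≤ 1) : unitUniform (Set.Iic d) = ENNReal.ofReal d := by
  rw [unitUniform, ProbabilityTheory.cond_apply measurableSet_Icc]
  have : Set.Icc (0 : ℝ) 1 ∩ Set.Iic d = Set.Icc 0 d := by
    ext x
    exact ⟨fun ⟨a, c⟩ => ⟨a.1, c⟩, fun ⟨a, b⟩ => ⟨⟨a, b.trans h1⟩, b⟩⟩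
  simp [this]

lemma unitUniform_Ioi {d : ℝ} (h1 : d ≤ 1) : unitUniform (Set.Ioi d) = 1 - ENNReal.ofReal d := by
  rw [← Set.compl_Iic, prob_compl_eq_one_sub measurableSet_Iic, unitUniform_Iic h1]

lemma dropProb_le_one (S : SensorSystem n m s) (i : Fin m) (y : EuclideanSpace ℝ (Fin (s i))) :
    dropProb S i y ≤ 1 := by
  rw [dropProb, Real.exp_le_one_iff]
  have h := (S.posDef_Y i).posSemidef.dotProduct_mulVec_nonneg y.ofLp
  simp only [star_trivial] at h
  linarith

/-- For a fixed measurement, each decision pattern corresponds to a box of randomizers. These boxes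
partition the space, and the product measure of each is a product of transmission and drop
probabilities. -/
lemma lintegral_packetFun (S : SensorSystem n m s) (y : MeasIdx s → ℝ) (ψ : Packet s → ℝ≥0∞) :
    ∫⁻ z, ψ (packetFun S y z) ∂Measure.pi (fun _ : Fin m => unitUniform) =
      ∑ g : Fin m → Bool, ψ (packOf g y) *
        ∏ i, (if g i = true then 1 - ENNReal.ofReal (dropProb S i (sensorBlock i y))
          else ENNReal.ofReal (dropProb S i (sensorBlock i y))) := by
  set B : (Fin m → Bool) → Set (Fin m → ℝ) := fun g => Set.univ.pi fun i =>
    if g i = true then Set.Ioi (dropProb S i (sensorBlock i y))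
      else Set.Iic (dropProb S i (sensorBlock i y)) with hB
  have hBm : ∀ g, MeasurableSet (B g) := fun g => MeasurableSet.univ_pi fun i => by
    split_ifs
    exacts [measurableSet_Ioi, measurableSet_Iic]
  have hmem : ∀ z g, z ∈ B g ↔ decisionFun S y z = g := by
    intro z g
    simp only [hB, Set.mem_univ_pi, funext_iff, decisionFun]
    refine forall_congr' fun i => ?_
    cases g i <;> simp
  have e : ∀ z, ψ (packetFun S y z) = ∑ g, ψ (packOf g y) * (B g).indicator 1 z := by
    intro z
    rw [Finset.sum_eq_single (decisionFun S y z)]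
    · simp [(hmem z _).2 rfl, packetFun]
    · intro g _ hg
      rw [Set.indicator_of_notMem (fun h => hg ((hmem z g).1 h).symm), mul_zero]
    · simp
  simp_rw [e]
  rw [lintegral_finsetSum _ fun g _ => by
    exact ((measurable_one.indicator (hBm g))).const_mul _]
  refine Finset.sum_congr rfl fun g _ => ?_
  rw [lintegral_const_mul _ (measurable_one.indicator (hBm g)), lintegral_indicator_one (hBm g),
    hB, Measure.pi_pi]
  congr 1
  refine Finset.prod_congr rfl fun i _ => ?_
  split_ifs
  · exact unitUniform_Ioi (dropProb_le_one S i _)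
  · exact unitUniform_Iic (dropProb_le_one S i _)

/-- A sensor transmits all its coordinates or none, so the split into seen and unseen coordinates
respects the blocks. This supplies the hypothesis `hYp` above. -/
lemma blockY_eq_zero (S : SensorSystem n m s) (g : Fin m → Bool) (p q : MeasIdx s)
    (hp : Transmitted g p) (hq : ¬ Transmitted g q) : S.blockY p q = 0 := by
  obtain ⟨i, a⟩ := p
  obtain ⟨j, b⟩ := q
  refine blockDiagonal'_apply_ne _ _ _ fun h => hq ?_
  subst h
  exact hp

lemma quadForm_blockY (S : SensorSystem n m s) (y : MeasIdx s → ℝ) :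
    y ⬝ᵥ S.blockY *ᵥ y = ∑ i, (sensorBlock i y).ofLp ⬝ᵥ S.Y i *ᵥ (sensorBlock i y).ofLp := by
  simp only [dotProduct, mulVec, Fintype.sum_sigma, SensorSystem.blockY, sensorBlock]
  refine Finset.sum_congr rfl fun i _ => Finset.sum_congr rfl fun a _ => ?_
  rw [Finset.sum_eq_single i]
  · simp [blockDiagonal'_apply_eq]
  · intro j _ hj
    refine Finset.sum_eq_zero fun b _ => ?_
    rw [blockDiagonal'_apply_ne _ _ _ hj.symm, zero_mul]
  · simp

lemma posDef_blockY (S : SensorSystem n m s) : S.blockY.PosDef := by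
  refine Matrix.PosDef.of_dotProduct_mulVec_pos ?_ fun y hy => ?_
  · rw [SensorSystem.blockY, IsHermitian, blockDiagonal'_conjTranspose]
    congr 1
    ext1 i
    exact (S.posDef_Y i).isHermitian
  · rw [star_trivial, quadForm_blockY]
    have hnn : ∀ i, 0 ≤ (sensorBlock i y).ofLp ⬝ᵥ S.Y i *ᵥ (sensorBlock i y).ofLp := fun i => by
      simpa using (S.posDef_Y i).posSemidef.dotProduct_mulVec_nonneg (sensorBlock i y).ofLp
    obtain ⟨⟨i, a⟩, hia⟩ := Function.ne_iff.1 hy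
    refine Finset.sum_pos' (fun i _ => hnn i) ⟨i, Finset.mem_univ _, ?_⟩
    have hne : (sensorBlock i y).ofLp ≠ 0 := Function.ne_iff.2 ⟨a, hia⟩
    simpa using (S.posDef_Y i).dotProduct_mulVec_pos hne

/-- Zeroing the transmitted blocks makes their drop probability `exp 0 = 1`, so the silent factors
multiply to one Gaussian weight on the unseen coordinates. -/
lemma prod_dropProb (S : SensorSystem n m s) (g : Fin m → Bool) (y : MeasIdx s → ℝ) :
    ∏ i, (if g i = true then 1 else ENNReal.ofReal (dropProb S i (sensorBlock i y))) =
      expQuad S.blockY (y - zeroFill (Transmitted g) y) := by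
  have e : ∀ i, (if g i = true then 1 else ENNReal.ofReal (dropProb S i (sensorBlock i y))) =
      ENNReal.ofReal (dropProb S i (sensorBlock i (y - zeroFill (Transmitted g) y))) := by
    intro i
    split_ifs with h
    · have : (sensorBlock i (y - zeroFill (Transmitted g) y)) = 0 := by
        ext j; simp [sensorBlock, zeroFill, Transmitted, h]
      simp [this, dropProb]
    · have : (sensorBlock i (y - zeroFill (Transmitted g) y)) = sensorBlock i y := by
        ext j; simp [sensorBlock, zeroFill, Transmitted, h]
      rw [this]
  simp_rw [e]
  rw [expQuad, quadForm_blockY, Finset.mul_sum, Real.exp_sum,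
    ENNReal.ofReal_prod_of_nonneg fun i _ => Real.exp_nonneg _]
  rfl

/-- The covariance in the innovation of the measurement update, without the term that is due to
the state. -/
noncomputable def SensorSystem.effectiveCov (S : SensorSystem n m s) (g : Fin m → Bool) :
    Matrix (MeasIdx s) (MeasIdx s) ℝ :=
  S.R + dropDiag (Transmitted g) * S.blockY⁻¹

lemma posDef_effectiveCov (S : SensorSystem n m s) (g : Fin m → Bool) :
    (S.effectiveCov g).PosDef :=
  posDef_add_dropDiag_mul_inv _ S.posDef_R (posDef_blockY S) (blockY_eq_zero S g)

/-- The measurement update of the covariance. -/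
noncomputable def SensorSystem.updateCov (S : SensorSystem n m s) (M : Matrix (Fin n) (Fin n) ℝ)
    (g : Fin m → Bool) : Matrix (Fin n) (Fin n) ℝ :=
  posteriorCov M S.stackedC (S.effectiveCov g)

lemma posDef_updateCov (S : SensorSystem n m s) {M : Matrix (Fin n) (Fin n) ℝ} (hM : M.PosDef)
    (g : Fin m → Bool) : (S.updateCov M g).PosDef :=
  posDef_posterior hM (posDef_effectiveCov S g) _

/-- The measurement update of the mean. -/
noncomputable def SensorSystem.updateMean (S : SensorSystem n m s) (M : Matrix (Fin n) (Fin n) ℝ)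
    (μ : EuclideanSpace ℝ (Fin n)) (p : Packet s) : EuclideanSpace ℝ (Fin n) :=
  posteriorMean M S.stackedC (S.effectiveCov p.1) μ p.fill

/-- For each decision pattern, the transmission probabilities join the test function and the drop
probabilities form the Gaussian weight. The partial observation identity then applies term by term.
-/
lemma lintegral_packet_update (S : SensorSystem n m s) {M : Matrix (Fin n) (Fin n) ℝ}
    (hM : M.PosDef) (μ : EuclideanSpace ℝ (Fin n)) {ψ : Packet s → ℝ≥0∞}
    {h : EuclideanSpace ℝ (Fin n) → ℝ≥0∞} (hψ : Measurable ψ) (hh : Measurable h) :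
    ∫⁻ x, ∫⁻ v, ∫⁻ z, ψ (packetFun S (S.stackedC *ᵥ x.ofLp + v.ofLp) z) * h x
        ∂Measure.pi (fun _ : Fin m => unitUniform)
        ∂multivariateGaussian 0 S.R ∂multivariateGaussian μ M =
      ∫⁻ x, ∫⁻ v, ∫⁻ z, ψ (packetFun S (S.stackedC *ᵥ x.ofLp + v.ofLp) z) *
        (∫⁻ x', h x' ∂multivariateGaussian
          (S.updateMean M μ (packetFun S (S.stackedC *ᵥ x.ofLp + v.ofLp) z))
          (S.updateCov M (packetFun S (S.stackedC *ᵥ x.ofLp + v.ofLp) z).1))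
        ∂Measure.pi (fun _ : Fin m => unitUniform)
        ∂multivariateGaussian 0 S.R ∂multivariateGaussian μ M := by
  set q : EuclideanSpace ℝ (Fin n) → EuclideanSpace ℝ (MeasIdx s) → MeasIdx s → ℝ :=
    fun x v => S.stackedC *ᵥ x.ofLp + v.ofLp with hq
  have hqc : Continuous fun a : EuclideanSpace ℝ (Fin n) × EuclideanSpace ℝ (MeasIdx s) =>
      S.stackedC *ᵥ a.1.ofLp + a.2.ofLp := by fun_prop
  have hqm := hqc.measurable
  -- Only transmitting sensors contribute to `τ g`, so it is unchanged by zero-filling (`hτz`), as a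
  -- test function must be.
  set τ : (Fin m → Bool) → (MeasIdx s → ℝ) → ℝ≥0∞ := fun g y =>
    ∏ i, (if g i = true then 1 - ENNReal.ofReal (dropProb S i (sensorBlock i y)) else 1) with hτ
  have hτm : ∀ g, Measurable (τ g) := fun g => by
    refine Finset.measurable_prod _ fun i _ => ?_
    split_ifs <;> fun_prop
  have hτz : ∀ g y, τ g (zeroFill (Transmitted g) y) = τ g y := fun g y => by
    refine Finset.prod_congr rfl fun i _ => ?_
    split_ifs with hi
    · congr 3
      ext j
      simp [sensorBlock, zeroFill, Transmitted, hi]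
    · rfl
  set E : (Fin m → Bool) → (MeasIdx s → ℝ) → ℝ≥0∞ := fun g y =>
    expQuad S.blockY (y - zeroFill (Transmitted g) y) with hE
  have hEm : ∀ g, Measurable (E g) := fun g => by
    simp only [hE]
    fun_prop
  have hsplit : ∀ (ψ : Packet s → ℝ≥0∞) (y : MeasIdx s → ℝ),
      ∫⁻ z, ψ (packetFun S y z) ∂Measure.pi (fun _ : Fin m => unitUniform) =
        ∑ g : Fin m → Bool, ψ (packOf g y) * (τ g y * E g y) := by
    intro ψ y
    rw [lintegral_packetFun]
    refine Finset.sum_congr rfl fun g _ => ?_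
    congr 1
    simp only [hE, hτ]
    rw [← prod_dropProb, ← Finset.prod_mul_distrib]
    refine Finset.prod_congr rfl fun i _ => ?_
    split_ifs <;> simp
  set J : (Fin m → Bool) → (MeasIdx s → ℝ) → ℝ≥0∞ := fun g y =>
    ∫⁻ x', h x' ∂multivariateGaussian (posteriorMean M S.stackedC (S.effectiveCov g) μ
      (zeroFill (Transmitted g) y)) (posteriorCov M S.stackedC (S.effectiveCov g)) with hJ
  have hJm : ∀ g, Measurable (J g) := fun g =>
    measurable_lintegral_multivariateGaussian _ (by fun_prop) hh
  have hψm : ∀ g, Measurable fun y => ψ (packOf g y) := fun g => hψ.comp (measurable_packOf g)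
  have hL : ∀ x v, ∫⁻ z, ψ (packetFun S (q x v) z) * h x
        ∂Measure.pi (fun _ : Fin m => unitUniform) =
      ∑ g : Fin m → Bool, ψ (packOf g (q x v)) * τ g (q x v) * E g (q x v) * h x := by
    intro x v
    rw [hsplit (fun p => ψ p * h x)]
    refine Finset.sum_congr rfl fun g _ => ?_
    ring
  have hR : ∀ x v, ∫⁻ z, ψ (packetFun S (q x v) z) *
        (∫⁻ x', h x' ∂multivariateGaussian
          (S.updateMean M μ (packetFun S (q x v) z)) (S.updateCov M (packetFun S (q x v) z).1))
        ∂Measure.pi (fun _ : Fin m => unitUniform) =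
      ∑ g : Fin m → Bool, ψ (packOf g (q x v)) * τ g (q x v) * E g (q x v) * J g (q x v) := by
    intro x v
    rw [hsplit (fun p => ψ p * ∫⁻ x', h x' ∂multivariateGaussian (S.updateMean M μ p)
      (S.updateCov M p.1))]
    refine Finset.sum_congr rfl fun g _ => ?_
    simp only [SensorSystem.updateMean, fill_packOf, SensorSystem.updateCov, hJ]
    change ψ (packOf g (q x v)) * (∫⁻ x', h x' ∂multivariateGaussian
      (posteriorMean M S.stackedC (S.effectiveCov g) μ (zeroFill (Transmitted g) (q x v)))
      (posteriorCov M S.stackedC (S.effectiveCov g))) * _ = _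
    ring
  have hsum : ∀ F : (Fin m → Bool) → EuclideanSpace ℝ (Fin n) → EuclideanSpace ℝ (MeasIdx s) → ℝ≥0∞,
      (∀ g, Measurable fun a : EuclideanSpace ℝ (Fin n) × EuclideanSpace ℝ (MeasIdx s) =>
        F g a.1 a.2) →
      ∫⁻ x, ∫⁻ v, ∑ g, F g x v ∂multivariateGaussian 0 S.R ∂multivariateGaussian μ M =
        ∑ g, ∫⁻ x, ∫⁻ v, F g x v ∂multivariateGaussian 0 S.R ∂multivariateGaussian μ M := by
    intro F hF
    rw [← lintegral_finsetSum _ fun g _ => (hF g).lintegral_prod_right']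
    refine lintegral_congr fun x => ?_
    exact lintegral_finsetSum _ fun g _ => (hF g).comp (measurable_const.prodMk measurable_id)
  change ∫⁻ x, ∫⁻ v, ∫⁻ z, ψ (packetFun S (q x v) z) * h x
        ∂Measure.pi (fun _ : Fin m => unitUniform)
        ∂multivariateGaussian 0 S.R ∂multivariateGaussian μ M =
    ∫⁻ x, ∫⁻ v, ∫⁻ z, ψ (packetFun S (q x v) z) *
        (∫⁻ x', h x' ∂multivariateGaussian
          (S.updateMean M μ (packetFun S (q x v) z)) (S.updateCov M (packetFun S (q x v) z).1))
        ∂Measure.pi (fun _ : Fin m => unitUniform)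
        ∂multivariateGaussian 0 S.R ∂multivariateGaussian μ M
  simp_rw [hL, hR]
  have hbase : ∀ g, Measurable fun a : EuclideanSpace ℝ (Fin n) × EuclideanSpace ℝ (MeasIdx s) =>
      ψ (packOf g (q a.1 a.2)) * τ g (q a.1 a.2) * E g (q a.1 a.2) := fun g =>
    (((hψm g).mul (hτm g)).mul (hEm g)).comp hqm
  rw [hsum _ fun g => (hbase g).mul (hh.comp measurable_fst),
    hsum _ fun g => (hbase g).mul ((hJm g).comp hqm)]
  refine Finset.sum_congr rfl fun g _ => ?_
  exact lintegral_gaussian_partial_observation (Transmitted g) hM S.posDef_R (posDef_blockY S)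
    (blockY_eq_zero S g) S.stackedC μ (φ := fun y => ψ (packOf g y) * τ g y)
    ((hψm g).mul (hτm g)) hh fun y => by rw [packOf_zeroFill, hτz]

end EventEstimation

-- Combining independent pairs, and identifying Gaussian laws.

section Independence

variable {Ω α₁ α₂ β₁ β₂ : Type*} [MeasurableSpace Ω] [MeasurableSpace α₁] [MeasurableSpace α₂]
  [MeasurableSpace β₁] [MeasurableSpace β₂] {P : Measure Ω} [IsProbabilityMeasure P]

lemma prod_prod_prod_comm (μ₁ : Measure α₁) (μ₂ : Measure α₂) (ν₁ : Measure β₁)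
    (ν₂ : Measure β₂) [SFinite μ₁] [SFinite μ₂] [SFinite ν₁] [SFinite ν₂] :
    ((μ₁.prod μ₂).prod (ν₁.prod ν₂)).map (fun q => ((q.1.1, q.2.1), (q.1.2, q.2.2))) =
      (μ₁.prod ν₁).prod (μ₂.prod ν₂) := by
  refine Measure.ext_of_lintegral _ fun f hf => ?_
  have hf' : ∀ {γ : Type _} [MeasurableSpace γ] {g : γ → (α₁ × β₁) × (α₂ × β₂)}, Measurable g →
      Measurable fun c => f (g c) := fun hg => hf.comp hg
  rw [lintegral_map hf (by fun_prop), lintegral_prod _ (by fun_prop),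
    lintegral_prod _ (by fun_prop), lintegral_prod _ (by fun_prop),
    lintegral_prod _ (by fun_prop)]
  refine lintegral_congr fun a₁ => ?_
  have e1 : ∀ a₂ : α₂, ∫⁻ b, f ((a₁, b.1), (a₂, b.2)) ∂ν₁.prod ν₂ =
      ∫⁻ b₁, ∫⁻ b₂, f ((a₁, b₁), (a₂, b₂)) ∂ν₂ ∂ν₁ := fun a₂ => lintegral_prod _ (by fun_prop)
  have e2 : ∀ b₁ : β₁, ∫⁻ y, f ((a₁, b₁), y) ∂μ₂.prod ν₂ =
      ∫⁻ a₂, ∫⁻ b₂, f ((a₁, b₁), (a₂, b₂)) ∂ν₂ ∂μ₂ := fun b₁ => lintegral_prod _ (by fun_prop)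
  simp only [e1, e2]
  exact lintegral_lintegral_swap
    (Measurable.lintegral_prod_right' (f := fun q : (α₂ × β₁) × β₂ =>
      f ((a₁, q.1.2), (q.1.1, q.2))) (by fun_prop)).aemeasurable

/-- The hypotheses make the joint law of the four variables a product of four marginals, which may
be regrouped at will. -/
lemma IndepFun.prodMk_prodMk_of_indepFun {X₁ : Ω → α₁} {X₂ : Ω → α₂} {Z₁ : Ω → β₁} {Z₂ : Ω → β₂}
    (hX₁ : Measurable X₁) (hX₂ : Measurable X₂) (hZ₁ : Measurable Z₁) (hZ₂ : Measurable Z₂)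
    (hX : IndepFun X₁ X₂ P) (hZ : IndepFun Z₁ Z₂ P)
    (hXZ : IndepFun (fun ω => (X₁ ω, X₂ ω)) (fun ω => (Z₁ ω, Z₂ ω)) P) :
    IndepFun (fun ω => (X₁ ω, Z₁ ω)) (fun ω => (X₂ ω, Z₂ ω)) P := by
  have h1 : IndepFun X₁ Z₁ P := hXZ.comp measurable_fst measurable_fst
  have h2 : IndepFun X₂ Z₂ P := hXZ.comp measurable_snd measurable_snd
  rw [indepFun_iff_map_prod_eq_prod_map_map (by fun_prop) (by fun_prop)] at hX hZ hXZ h1 h2 ⊢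
  rw [h1, h2, ← prod_prod_prod_comm, ← hX, ← hZ, ← hXZ, Measure.map_map (by fun_prop) (by fun_prop)]
  rfl

end Independence

section GaussianLaw

variable {Ω ι : Type*} [MeasurableSpace Ω] [Fintype ι] [DecidableEq ι] {P : Measure Ω}

/-- A Gaussian law is determined by its mean and covariance form, and the latter need only be
compared on the standard basis. -/
lemma HasGaussianLaw.map_eq_multivariateGaussian {X : Ω → EuclideanSpace ℝ ι}
    (hX : HasGaussianLaw X P) (hXm : Measurable X) (hmean : ∀ i, ∫ ω, X ω i ∂P = 0)
    {S : Matrix ι ι ℝ} (hS : S.PosSemidef)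
    (hcov : ∀ i j, cov[fun ω => X ω i, fun ω => X ω j; P] = S i j) :
    P.map X = multivariateGaussian 0 S := by
  have := hX.isGaussian_map
  apply IsGaussian.ext
  · simp only [id_eq, integral_id_multivariateGaussian]
    rw [integral_map hXm.aemeasurable (by fun_prop)]
    ext i
    have h : ∫ ω, X ω i ∂P = (∫ ω, X ω ∂P) i :=
      ContinuousLinearMap.integral_comp_comm (EuclideanSpace.proj (𝕜 := ℝ) i) hX.integrable
    rw [← h, hmean]
    rfl
  rw [← ContinuousLinearMap.toBilinForm_inj]
  refine LinearMap.BilinForm.ext_basis (EuclideanSpace.basisFun ι ℝ).toBasis fun i j => ?_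
  rw [ContinuousLinearMap.toBilinForm_apply, ContinuousLinearMap.toBilinForm_apply,
    covarianceBilin_apply_eq_cov, covariance_map]
  · have (i : ι) : (fun u => ⟪(EuclideanSpace.basisFun ι ℝ).toBasis i, u⟫) ∘ X =
        fun ω => X ω i := by ext; simp [PiLp.inner_apply]
    simp_rw [this, hcov, covarianceBilin_multivariateGaussian hS]
    simp
  any_goals exact Measurable.aestronglyMeasurable (by fun_prop)
  · fun_prop
  · exact IsGaussian.memLp_two_id

lemma IsGaussianProcess.hasGaussianLaw_toLp {T : Type*} {G : T → Ω → ℝ}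
    (hG : IsGaussianProcess G P) (f : ι → T) :
    HasGaussianLaw (fun ω => (WithLp.toLp 2 fun i => G (f i) ω : EuclideanSpace ℝ ι)) P := by
  have h := (hG.comp_right f).hasGaussianLaw Finset.univ
  let L : (↥(Finset.univ : Finset ι) → ℝ) →ₗ[ℝ] EuclideanSpace ℝ ι :=
    { toFun := fun x => WithLp.toLp 2 fun i => x ⟨i, Finset.mem_univ i⟩
      map_add' := fun x y => rfl
      map_smul' := fun c x => rfl }
  exact h.map (LinearMap.toContinuousLinearMap L)

end GaussianLaw

-- Which inputs the states and packets depend on, and the resulting independence.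

namespace EventEstimation

variable {Ω : Type*} {n m : ℕ} {s : Fin m → ℕ}

section Measurability

variable {m' : MeasurableSpace Ω} [MeasurableSpace Ω] (S : SensorSystem n m s)
  {I : RandomInputs Ω n m s}

lemma measurable_pi_of {α δ : Type*} {X : δ → Type*} {m' : MeasurableSpace α}
    [∀ a, MeasurableSpace (X a)] {f : α → ∀ a, X a} (hf : ∀ a, Measurable[m'] fun c => f c a) :
    Measurable[m'] f :=
  measurable_pi_lambda f hf

lemma measurable_toLp_of {α ι : Type*} [Fintype ι] {m' : MeasurableSpace α}
    {X : α → EuclideanSpace ℝ ι} (h : ∀ i, Measurable[m'] fun ω => X ω i) : Measurable[m'] X := by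
  have h1 : Measurable (WithLp.toLp 2 : (ι → ℝ) → EuclideanSpace ℝ ι) := by fun_prop
  exact h1.comp (measurable_pi_lambda _ h)

/-- The σ-algebra `m'` is left free so that the same argument serves the ambient σ-algebra and the
one generated by a selection of inputs. -/
lemma measurable_state_of {k : ℕ} (h0 : Measurable[m'] I.x0)
    (hw : ∀ j < k, Measurable[m'] (I.w j)) : Measurable[m'] (state S I k) := by
  induction k with
  | zero => exact h0
  | succ k ih =>
    have hA : Measurable S.A.toEuclideanLin :=
      S.A.toEuclideanLin.continuous_of_finiteDimensional.measurable
    exact (hA.comp (ih fun j hj => hw j (hj.trans (Nat.lt_succ_self k)))).add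
      (hw k (Nat.lt_succ_self k))

lemma measurable_stackedMeas_of {k : ℕ}
    (hx : Measurable[m'] (state S I k)) (hv : Measurable[m'] (I.v k)) :
    Measurable[m'] fun ω => (stackedMeas S I k ω).ofLp := by
  have hc : Continuous fun a : EuclideanSpace ℝ (Fin n) × EuclideanSpace ℝ (MeasIdx s) =>
      S.stackedC *ᵥ a.1.ofLp + a.2.ofLp := by fun_prop
  exact hc.measurable.comp (hx.prodMk hv)

lemma measurable_packet_of {k : ℕ}
    (hx : Measurable[m'] (state S I k)) (hv : Measurable[m'] (I.v k))
    (hζ : ∀ i, Measurable[m'] (I.ζ k i)) : Measurable[m'] (packet S I k) := by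
  have hq : Measurable[m'] fun ω => ((stackedMeas S I k ω).ofLp, fun i => I.ζ k i ω) :=
    (measurable_stackedMeas_of S hx hv).prodMk (measurable_pi_of hζ)
  have e : packet S I k = (fun q : (MeasIdx s → ℝ) × (Fin m → ℝ) => packetFun S q.1 q.2) ∘
      fun ω => ((stackedMeas S I k ω).ofLp, fun i => I.ζ k i ω) := rfl
  rw [e]
  exact (measurable_packetFun S).comp hq

lemma measurable_info_of {l : ℕ}
    (h : ∀ j < l, Measurable[m'] (packet S I j)) : Measurable[m'] (info S I l) :=
  measurable_pi_of fun j => h j j.2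

end Measurability

section Selection

variable [MeasurableSpace Ω] (S : SensorSystem n m s) (I : RandomInputs Ω n m s)

lemma measurable_gaussianInput (a : GaussianLabel n s) : Measurable (I.gaussianInput a) := by
  have h1 := I.measurable_x0
  have h2 := I.measurable_w
  have h3 := I.measurable_v
  cases a with
  | init i => exact (by fun_prop : Measurable fun ω => I.x0 ω i)
  | proc k i => exact (by fun_prop : Measurable fun ω => I.w k ω i)
  | meas k q => exact (by fun_prop : Measurable fun ω => I.v k ω q)

/-- The labels of the Gaussian inputs that enter the measurements before time `l` and the states
up to time `k`. -/
def pastLabels (n : ℕ) {m : ℕ} (s : Fin m → ℕ) (k l : ℕ) : Set (GaussianLabel n s)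
  | .init _ => True
  | .proc j _ => j < k
  | .meas j _ => j < l

lemma measurable_state (k : ℕ) : Measurable (state S I k) :=
  measurable_state_of S I.measurable_x0 fun j _ => I.measurable_w j

lemma measurable_packet (k : ℕ) : Measurable (packet S I k) :=
  measurable_packet_of S (measurable_state S I k) (I.measurable_v k) (I.measurable_ζ k)

lemma measurable_info (k : ℕ) : Measurable (info S I k) :=
  measurable_info_of S fun j _ => measurable_packet S I j

/-- A collection of Gaussian inputs and of randomizing variables. -/
def RandomInputs.select (A : Set (GaussianLabel n s)) (T : Finset (ℕ × Fin m)) (ω : Ω) :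
    (A → ℝ) × (T → ℝ) :=
  (fun a => I.gaussianInput a ω, fun q => I.ζ q.1.1 q.1.2 ω)

lemma measurable_comap_select_gaussian (A : Set (GaussianLabel n s)) (T : Finset (ℕ × Fin m))
    {a : GaussianLabel n s} (ha : a ∈ A) :
    Measurable[MeasurableSpace.comap (I.select A T) inferInstance] (I.gaussianInput a) := by
  have h : Measurable fun q : (A → ℝ) × (T → ℝ) => q.1 ⟨a, ha⟩ := by fun_prop
  exact h.comp (comap_measurable (I.select A T))

lemma measurable_comap_select_ζ (A : Set (GaussianLabel n s)) (T : Finset (ℕ × Fin m))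
    {j : ℕ} {i : Fin m} (hj : (j, i) ∈ T) :
    Measurable[MeasurableSpace.comap (I.select A T) inferInstance] (I.ζ j i) := by
  have h : Measurable fun q : (A → ℝ) × (T → ℝ) => q.2 ⟨(j, i), hj⟩ := by fun_prop
  exact h.comp (comap_measurable (I.select A T))

lemma measurable_comap_select_state {k l : ℕ} (T : Finset (ℕ × Fin m)) :
    Measurable[MeasurableSpace.comap (I.select (pastLabels n s k l) T) inferInstance]
      (state S I k) :=
  measurable_state_of S
    (measurable_toLp_of fun i => measurable_comap_select_gaussian I (pastLabels n s k l) T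
      (a := .init i) trivial)
    fun j hj => measurable_toLp_of fun i =>
      measurable_comap_select_gaussian I (pastLabels n s k l) T (a := .proc j i) hj

lemma measurable_comap_select_info {k l : ℕ} (hlk : l ≤ k + 1) :
    Measurable[MeasurableSpace.comap
      (I.select (pastLabels n s k l) (Finset.range l ×ˢ Finset.univ)) inferInstance]
      (info S I l) := by
  refine measurable_info_of S fun j hj => measurable_packet_of S
    (measurable_state_of S ?_ fun j' hj' => ?_) ?_ fun i => ?_
  · exact measurable_toLp_of fun i =>
      measurable_comap_select_gaussian I _ _ (a := .init i) trivial
  · exact measurable_toLp_of fun i => measurable_comap_select_gaussian I _ _ (a := .proc j' i)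
      -- The packet at time `j < l` involves the process noise at times `j' < j`, and `l ≤ k + 1`
      -- gives `j ≤ k`.
      (show j' < k by omega)
  · exact measurable_toLp_of fun q => measurable_comap_select_gaussian I _ _ (a := .meas j q) hj
  · exact measurable_comap_select_ζ I _ _ (by simp [hj])

end Selection

section Model

variable [MeasurableSpace Ω] {P : Measure Ω} [IsProbabilityMeasure P] {S : SensorSystem n m s}
  {I : RandomInputs Ω n m s}

/-- Uncorrelated parts of a jointly Gaussian family are independent, disjoint sets of randomizers
are independent, and the two families are independent of each other. -/
lemma IsModel.indepFun_select (hSI : IsModel S I P) {A B : Set (GaussianLabel n s)}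
    {T U : Finset (ℕ × Fin m)} (hAB : ∀ a ∈ A, ∀ b ∈ B, S.inputCov a b = 0) (hTU : Disjoint T U) :
    IndepFun (I.select A T) (I.select B U) P := by
  have hG := measurable_gaussianInput I
  refine IndepFun.prodMk_prodMk_of_indepFun (by fun_prop) (by fun_prop)
    (measurable_pi_lambda _ fun q => I.measurable_ζ _ _)
    (measurable_pi_lambda _ fun q => I.measurable_ζ _ _) ?_ ?_ ?_
  · refine IsGaussianProcess.indepFun_of_covariance_eq_zero (X := fun a : A => I.gaussianInput a)
      (Y := fun b : B => I.gaussianInput b) ?_ (fun a => (hG _).aemeasurable)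
      (fun a => (hG _).aemeasurable) fun a b => ?_
    · have e : Sum.elim (fun a : A => I.gaussianInput a) (fun b : B => I.gaussianInput b) =
          I.gaussianInput ∘ Sum.elim Subtype.val Subtype.val := by
        funext c
        cases c <;> rfl
      rw [e]
      exact hSI.gaussian.comp_right _
    · rw [hSI.cov_eq, hAB a a.2 b b.2]
  · exact hSI.indep_ζ.indepFun_finset T U hTU fun q => I.measurable_ζ _ _
  · exact hSI.indep_gaussian_ζ.comp
      (φ := fun g => ((fun a : A => g a, fun b : B => g b) : (A → ℝ) × (B → ℝ)))
      (ψ := fun z => ((fun a : T => z a, fun b : U => z b) : (T → ℝ) × (U → ℝ)))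
      (by fun_prop) (by fun_prop)

lemma IsModel.map_x0 (hSI : IsModel S I P) : P.map I.x0 = multivariateGaussian 0 S.S0 := by
  refine HasGaussianLaw.map_eq_multivariateGaussian ?_ I.measurable_x0
    (fun i => hSI.mean_zero (.init i)) S.posDef_S0.posSemidef
    fun i j => hSI.cov_eq (.init i) (.init j)
  exact IsGaussianProcess.hasGaussianLaw_toLp hSI.gaussian fun i => .init i

lemma IsModel.hasGaussianLaw_w (hSI : IsModel S I P) (k : ℕ) : HasGaussianLaw (I.w k) P :=
  IsGaussianProcess.hasGaussianLaw_toLp hSI.gaussian fun i => .proc k i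

lemma IsModel.hasGaussianLaw_x0 (hSI : IsModel S I P) : HasGaussianLaw I.x0 P :=
  IsGaussianProcess.hasGaussianLaw_toLp hSI.gaussian fun i => .init i

lemma IsModel.map_w (hSI : IsModel S I P) (k : ℕ) :
    P.map (I.w k) = multivariateGaussian 0 S.Q := by
  refine HasGaussianLaw.map_eq_multivariateGaussian (hSI.hasGaussianLaw_w k) (I.measurable_w k)
    (fun i => hSI.mean_zero (.proc k i)) S.posDef_Q.posSemidef
    fun i j => (hSI.cov_eq (.proc k i) (.proc k j)).trans ?_
  simp [SensorSystem.inputCov]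

lemma IsModel.map_v (hSI : IsModel S I P) (k : ℕ) :
    P.map (I.v k) = multivariateGaussian 0 S.R := by
  refine HasGaussianLaw.map_eq_multivariateGaussian ?_ (I.measurable_v k)
    (fun i => hSI.mean_zero (.meas k i)) S.posDef_R.posSemidef
    fun i j => (hSI.cov_eq (.meas k i) (.meas k j)).trans ?_
  · exact IsGaussianProcess.hasGaussianLaw_toLp hSI.gaussian fun i => .meas k i
  · simp [SensorSystem.inputCov]

lemma IsModel.map_ζ (hSI : IsModel S I P) (k : ℕ) :
    P.map (fun ω i => I.ζ k i ω) = Measure.pi fun _ : Fin m => unitUniform := by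
  have h := hSI.indep_ζ.precomp (g := fun i : Fin m => (k, i)) (fun i j h => by simpa using h)
  rw [iIndepFun_iff_map_fun_eq_pi_map fun i => (I.measurable_ζ k i).aemeasurable] at h
  rw [h]
  congr 1
  ext1 i
  exact hSI.uniform k i

lemma IsModel.map_v_ζ (hSI : IsModel S I P) (k : ℕ) :
    P.map (fun ω => (I.v k ω, fun i => I.ζ k i ω)) =
      (multivariateGaussian 0 S.R).prod (Measure.pi fun _ : Fin m => unitUniform) := by
  have h : IndepFun (I.v k) (fun ω i => I.ζ k i ω) P :=
    IndepFun.comp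
      (φ := fun g : GaussianLabel n s → ℝ =>
        (WithLp.toLp 2 fun q => g (.meas k q) : EuclideanSpace ℝ (MeasIdx s)))
      (ψ := fun (z : ℕ × Fin m → ℝ) (i : Fin m) => z (k, i)) hSI.indep_gaussian_ζ
      (by fun_prop) (by fun_prop)
  rw [indepFun_iff_map_prod_eq_prod_map_map (I.measurable_v k).aemeasurable
    (measurable_pi_lambda _ (I.measurable_ζ k)).aemeasurable] at h
  rw [h, hSI.map_v, hSI.map_ζ]

lemma IsModel.indepFun_past_measurement (hSI : IsModel S I P) (k : ℕ) :
    IndepFun (fun ω => (info S I k ω, state S I k ω))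
      (fun ω => (I.v k ω, fun i => I.ζ k i ω)) P := by
  have h := hSI.indepFun_select (A := pastLabels n s k k) (B := {a | ∃ q, a = .meas k q})
    (T := Finset.range k ×ˢ Finset.univ) (U := {k} ×ˢ Finset.univ) ?_ ?_
  · rw [IndepFun_iff_Indep] at h ⊢
    refine indep_of_indep_of_le_left (indep_of_indep_of_le_right h ?_) ?_
    · rw [← measurable_iff_comap_le]
      refine Measurable.prodMk ?_ (measurable_pi_of fun i => ?_)
      · exact measurable_toLp_of fun q =>
          measurable_comap_select_gaussian I _ _ (a := .meas k q) ⟨q, rfl⟩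
      · exact measurable_comap_select_ζ I _ _ (by simp)
    · rw [← measurable_iff_comap_le]
      exact (measurable_comap_select_info S I (by omega)).prodMk
        (measurable_comap_select_state S I _)
  · rintro (i | ⟨j, i⟩ | ⟨j, q⟩) ha b ⟨q', rfl⟩
    · rfl
    · rfl
    · have hj : j < k := ha
      simp [SensorSystem.inputCov, hj.ne]
  · rw [Finset.disjoint_left]
    rintro ⟨j, i⟩ hj hj'
    simp at hj hj'
    omega

lemma IsModel.indepFun_past_noise (hSI : IsModel S I P) (k : ℕ) :
    IndepFun (fun ω => (info S I (k + 1) ω, state S I k ω)) (I.w k) P := by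
  -- The packets through time `k` contain the measurement noise at time `k`, but process noise only
  -- at times before `k`. No randomizer enters `w k`, so `U` is empty.
  have h := hSI.indepFun_select (A := pastLabels n s k (k + 1)) (B := {a | ∃ q, a = .proc k q})
    (T := Finset.range (k + 1) ×ˢ Finset.univ) (U := ∅) ?_ (by simp)
  · rw [IndepFun_iff_Indep] at h ⊢
    refine indep_of_indep_of_le_left (indep_of_indep_of_le_right h ?_) ?_
    · rw [← measurable_iff_comap_le]
      exact measurable_toLp_of fun q =>
          measurable_comap_select_gaussian I _ _ (a := .proc k q) ⟨q, rfl⟩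
    · rw [← measurable_iff_comap_le]
      exact (measurable_comap_select_info S I le_rfl).prodMk
        (measurable_comap_select_state S I _)
  · rintro (i | ⟨j, i⟩ | ⟨j, q⟩) ha b ⟨q', rfl⟩
    · rfl
    · have hj : j < k := ha
      simp [SensorSystem.inputCov, hj.ne]
    · rfl

end Model

end EventEstimation

-- Gaussian laws under the linear dynamics.

section LinearImage

variable {κ : Type*} [Fintype κ] [DecidableEq κ]

lemma charFun_map_toEuclideanLin (A : Matrix κ κ ℝ) (ν : Measure (EuclideanSpace ℝ κ))
    (t : EuclideanSpace ℝ κ) :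
    charFun (ν.map A.toEuclideanLin) t = charFun ν (Aᵀ.toEuclideanLin t) := by
  have hA : Measurable A.toEuclideanLin :=
    A.toEuclideanLin.continuous_of_finiteDimensional.measurable
  rw [charFun_apply, charFun_apply, integral_map hA.aemeasurable (by fun_prop)]
  congr 1
  ext1 x
  congr 3
  simp only [EuclideanSpace.inner_eq_star_dotProduct, star_trivial]
  change t.ofLp ⬝ᵥ A *ᵥ x.ofLp = (Aᵀ *ᵥ t.ofLp) ⬝ᵥ x.ofLp
  rw [dotProduct_mulVec, ← mulVec_transpose]

/-- The law of `A x + w` for independent Gaussian vectors `x` and `w`. -/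
lemma multivariateGaussian_map_conv (A : Matrix κ κ ℝ) (μ : EuclideanSpace ℝ κ)
    {M Q : Matrix κ κ ℝ} (hM : M.PosSemidef) (hQ : Q.PosSemidef) :
    ((multivariateGaussian μ M).map A.toEuclideanLin).conv (multivariateGaussian 0 Q) =
      multivariateGaussian (A.toEuclideanLin μ) (A * M * Aᵀ + Q) := by
  have hA : Measurable A.toEuclideanLin :=
    A.toEuclideanLin.continuous_of_finiteDimensional.measurable
  have : IsProbabilityMeasure ((multivariateGaussian μ M).map A.toEuclideanLin) :=
    Measure.isProbabilityMeasure_map hA.aemeasurable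
  have hS : (A * M * Aᵀ + Q).PosSemidef := by
    refine Matrix.PosSemidef.add ?_ hQ
    have h := hM.mul_mul_conjTranspose_same A
    rwa [conjTranspose_eq_transpose_of_trivial] at h
  refine Measure.ext_of_charFun (funext fun t => ?_)
  rw [charFun_conv, charFun_map_toEuclideanLin, charFun_multivariateGaussian hM,
    charFun_multivariateGaussian hQ, charFun_multivariateGaussian hS, ← Complex.exp_add]
  have e1 : ⟪Aᵀ.toEuclideanLin t, μ⟫ = ⟪t, A.toEuclideanLin μ⟫ := by
    simp only [EuclideanSpace.inner_eq_star_dotProduct, star_trivial]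
    change μ.ofLp ⬝ᵥ Aᵀ *ᵥ t.ofLp = (A *ᵥ μ.ofLp) ⬝ᵥ t.ofLp
    rw [dotProduct_mulVec, vecMul_transpose]
  have e2 : (Aᵀ.toEuclideanLin t).ofLp ⬝ᵥ M *ᵥ (Aᵀ.toEuclideanLin t).ofLp =
      t.ofLp ⬝ᵥ (A * M * Aᵀ) *ᵥ t.ofLp := by
    change (Aᵀ *ᵥ t.ofLp) ⬝ᵥ M *ᵥ (Aᵀ *ᵥ t.ofLp) = _
    rw [← mulVec_mulVec, ← mulVec_mulVec, dotProduct_mulVec t.ofLp A, ← mulVec_transpose]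
  rw [e1, e2, add_mulVec, dotProduct_add]
  congr 1
  simp only [inner_zero_right]
  push_cast
  ring

lemma lintegral_multivariateGaussian_linear (A : Matrix κ κ ℝ) (μ : EuclideanSpace ℝ κ)
    {M Q : Matrix κ κ ℝ} (hM : M.PosSemidef) (hQ : Q.PosSemidef)
    {h : EuclideanSpace ℝ κ → ℝ≥0∞} (hh : Measurable h) :
    ∫⁻ x, ∫⁻ w, h (A.toEuclideanLin x + w) ∂multivariateGaussian 0 Q ∂multivariateGaussian μ M =
      ∫⁻ x, h x ∂multivariateGaussian (A.toEuclideanLin μ) (A * M * Aᵀ + Q) := by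
  have hA : Measurable A.toEuclideanLin :=
    A.toEuclideanLin.continuous_of_finiteDimensional.measurable
  rw [← multivariateGaussian_map_conv A μ hM hQ, Measure.lintegral_conv hh, lintegral_map _ hA]
  exact Measurable.lintegral_prod_right'
    (f := fun q : EuclideanSpace ℝ κ × EuclideanSpace ℝ κ => h (q.1 + q.2)) (by fun_prop)

end LinearImage

-- Gaussian conditional laws and their recursion.

namespace EventEstimation

variable {Ω : Type*} {n m : ℕ} {s : Fin m → ℕ}

section Kernel

variable {l : ℕ}

/-- The decisions in a sequence of packets. -/
def decisionsOf (i : Fin l → Packet s) : Fin l → Fin m → Bool := fun j => (i j).1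

@[fun_prop]
lemma measurable_decisionsOf : Measurable (decisionsOf : (Fin l → Packet s) → _) :=
  measurable_pi_lambda _ fun j => measurable_packet_fst.comp (measurable_pi_apply j)

/-- The Gaussian kernel with given mean, and with a covariance that depends on the decisions
only. -/
noncomputable def gaussKernel (c : (Fin l → Fin m → Bool) → Matrix (Fin n) (Fin n) ℝ)
    {μ : (Fin l → Packet s) → EuclideanSpace ℝ (Fin n)} (hμ : Measurable μ) :
    Kernel (Fin l → Packet s) (EuclideanSpace ℝ (Fin n)) where
  toFun i := multivariateGaussian (μ i) (c (decisionsOf i))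
  measurable' := by
    refine Measure.measurable_of_measurable_coe _ fun B hB => ?_
    -- The covariance index ranges over a finite set, so only measurability in the mean has to be
    -- shown.
    have h : Measurable fun q : (Fin l → Fin m → Bool) × (Fin l → Packet s) =>
        multivariateGaussian (μ q.2) (c q.1) B := by
      refine measurable_from_prod_countable_right fun g => ?_
      have h1 := measurable_lintegral_multivariateGaussian (c g) hμ
        (h := B.indicator 1) (measurable_one.indicator hB)
      simpa only [lintegral_indicator_one hB] using h1
    exact h.comp (measurable_decisionsOf.prodMk measurable_id)

lemma gaussKernel_apply (c : (Fin l → Fin m → Bool) → Matrix (Fin n) (Fin n) ℝ)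
    {μ : (Fin l → Packet s) → EuclideanSpace ℝ (Fin n)} (hμ : Measurable μ)
    (i : Fin l → Packet s) :
    gaussKernel c hμ i = multivariateGaussian (μ i) (c (decisionsOf i)) := rfl

instance (c : (Fin l → Fin m → Bool) → Matrix (Fin n) (Fin n) ℝ)
    {μ : (Fin l → Packet s) → EuclideanSpace ℝ (Fin n)} (hμ : Measurable μ) :
    IsMarkovKernel (gaussKernel c hμ) :=
  ⟨fun i => by rw [gaussKernel_apply]; infer_instance⟩

end Kernel

section CondGaussian

variable [MeasurableSpace Ω] {P : Measure Ω} [IsProbabilityMeasure P] {l : ℕ}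

/-- Given the packets `Z`, the vector `X` is Gaussian with mean `μ Z` and with a positive definite
covariance matrix `c` that depends on the decisions only. -/
structure CondGaussian (P : Measure Ω) (X : Ω → EuclideanSpace ℝ (Fin n))
    (Z : Ω → Fin l → Packet s) (c : (Fin l → Fin m → Bool) → Matrix (Fin n) (Fin n) ℝ)
    (μ : (Fin l → Packet s) → EuclideanSpace ℝ (Fin n)) : Prop where
  measurable_mean : Measurable μ
  posDef : ∀ g, (c g).PosDef
  map_eq : P.map (fun ω => (Z ω, X ω)) = P.map Z ⊗ₘ gaussKernel c measurable_mean

variable {X : Ω → EuclideanSpace ℝ (Fin n)} {Z : Ω → Fin l → Packet s}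
  {c : (Fin l → Fin m → Bool) → Matrix (Fin n) (Fin n) ℝ}
  {μ : (Fin l → Packet s) → EuclideanSpace ℝ (Fin n)}

lemma measurable_lintegral_gaussian (c : (Fin l → Fin m → Bool) → Matrix (Fin n) (Fin n) ℝ)
    (hμ : Measurable μ) {F : (Fin l → Packet s) × EuclideanSpace ℝ (Fin n) → ℝ≥0∞}
    (hF : Measurable F) :
    Measurable fun i => ∫⁻ x, F (i, x) ∂multivariateGaussian (μ i) (c (decisionsOf i)) :=
  Measurable.lintegral_kernel_prod_right' (κ := gaussKernel c hμ) hF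

lemma CondGaussian.lintegral_eq (h : CondGaussian P X Z c μ) (hX : Measurable X)
    (hZ : Measurable Z) {F : (Fin l → Packet s) × EuclideanSpace ℝ (Fin n) → ℝ≥0∞}
    (hF : Measurable F) :
    ∫⁻ ω, F (Z ω, X ω) ∂P =
      ∫⁻ ω, ∫⁻ x, F (Z ω, x) ∂multivariateGaussian (μ (Z ω)) (c (decisionsOf (Z ω))) ∂P := by
  have h1 := measurable_lintegral_gaussian c h.measurable_mean hF
  rw [← lintegral_map hF (hZ.prodMk hX), h.map_eq, Measure.lintegral_compProd hF,
    ← lintegral_map h1 hZ]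
  rfl

/-- Product test functions suffice because finite measures on a product are determined by
rectangles. -/
lemma CondGaussian.of_lintegral_eq (hX : Measurable X) (hZ : Measurable Z) (hμ : Measurable μ)
    (hc : ∀ g, (c g).PosDef)
    (h : ∀ (f : (Fin l → Packet s) → ℝ≥0∞) (h : EuclideanSpace ℝ (Fin n) → ℝ≥0∞),
      Measurable f → Measurable h → ∫⁻ ω, f (Z ω) * h (X ω) ∂P =
        ∫⁻ ω, f (Z ω) *
          ∫⁻ x, h x ∂multivariateGaussian (μ (Z ω)) (c (decisionsOf (Z ω))) ∂P) :
    CondGaussian P X Z c μ where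
  measurable_mean := hμ
  posDef := hc
  map_eq := by
    have : IsProbabilityMeasure (P.map fun ω => (Z ω, X ω)) :=
      Measure.isProbabilityMeasure_map (hZ.prodMk hX).aemeasurable
    refine Measure.ext_prod fun {B D} hB hD => ?_
    have hB1 : Measurable (B.indicator (1 : (Fin l → Packet s) → ℝ≥0∞)) :=
      measurable_one.indicator hB
    have hD1 : Measurable (D.indicator (1 : EuclideanSpace ℝ (Fin n) → ℝ≥0∞)) :=
      measurable_one.indicator hD
    have hBD : Measurable ((B ×ˢ D).indicator
        (1 : (Fin l → Packet s) × EuclideanSpace ℝ (Fin n) → ℝ≥0∞)) :=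
      measurable_one.indicator (hB.prod hD)
    have e : ∀ i x, (B ×ˢ D).indicator
        (1 : (Fin l → Packet s) × EuclideanSpace ℝ (Fin n) → ℝ≥0∞) (i, x) =
        B.indicator 1 i * D.indicator 1 x := by
      intro i x
      by_cases hi : i ∈ B <;> by_cases hx : x ∈ D <;> simp [hi, hx]
    have hm : Measurable fun i => ∫⁻ x,
        B.indicator (1 : (Fin l → Packet s) → ℝ≥0∞) i * D.indicator 1 x
        ∂multivariateGaussian (μ i) (c (decisionsOf i)) :=
      measurable_lintegral_gaussian c hμ
        (F := fun q => B.indicator (1 : (Fin l → Packet s) → ℝ≥0∞) q.1 * D.indicator 1 q.2)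
        ((hB1.comp measurable_fst).mul (hD1.comp measurable_snd))
    rw [← lintegral_indicator_one (hB.prod hD), ← lintegral_indicator_one (hB.prod hD),
      lintegral_map hBD (hZ.prodMk hX), Measure.lintegral_compProd hBD]
    simp only [e, gaussKernel_apply]
    rw [h _ _ hB1 hD1, lintegral_map hm hZ]
    refine lintegral_congr fun ω => ?_
    rw [lintegral_const_mul _ hD1]

end CondGaussian

section Recursion

variable [MeasurableSpace Ω] {P : Measure Ω} [IsProbabilityMeasure P] {S : SensorSystem n m s}
  {I : RandomInputs Ω n m s}

lemma condGaussian_zero (hSI : IsModel S I P) :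
    CondGaussian P (state S I 0) (info S I 0) (fun _ => S.S0) (fun _ => 0) := by
  refine CondGaussian.of_lintegral_eq (measurable_state S I 0) (measurable_info S I 0)
    measurable_const (fun _ => S.posDef_S0) fun f h _ hh => ?_
  have e : ∀ ω, info S I 0 ω = fun j => j.elim0 := fun ω => funext fun j => j.elim0
  simp only [e]
  have hx : Measurable (state S I 0) := measurable_state S I 0
  have hhx : Measurable fun ω => h (state S I 0 ω) := hh.comp hx
  rw [lintegral_const_mul _ hhx, ← lintegral_map hh hx, lintegral_const, measure_univ,
    mul_one]
  change _ * ∫⁻ a, h a ∂P.map I.x0 = _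
  rw [hSI.map_x0]

lemma lintegral_of_indepFun {α β δ : Type*} [MeasurableSpace α] [MeasurableSpace β]
    [MeasurableSpace δ] {X : Ω → α} {V : Ω → β} {U : Ω → δ} {ν : Measure β} {η : Measure δ}
    [SFinite ν] [SFinite η] (hX : Measurable X) (hV : Measurable V) (hU : Measurable U)
    (hind : IndepFun X (fun ω => (V ω, U ω)) P) (hVU : P.map (fun ω => (V ω, U ω)) = ν.prod η)
    {F : α × β × δ → ℝ≥0∞} (hF : Measurable F) :
    ∫⁻ ω, F (X ω, V ω, U ω) ∂P = ∫⁻ ω, ∫⁻ v, ∫⁻ u, F (X ω, v, u) ∂η ∂ν ∂P := by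
  rw [indepFun_iff_map_prod_eq_prod_map_map hX.aemeasurable (hV.prodMk hU).aemeasurable,
    hVU] at hind
  rw [← lintegral_map hF (hX.prodMk (hV.prodMk hU)), hind, lintegral_prod _ hF.aemeasurable,
    lintegral_map hF.lintegral_prod_right' hX]
  refine lintegral_congr fun ω => ?_
  exact lintegral_prod _ (hF.comp (measurable_const.prodMk measurable_id)).aemeasurable

/-- The current noise and randomizers are independent of the past packets and the state, so they
integrate out with their own laws; the state then integrates out by its conditional law `h`. -/
lemma IsModel.lintegral_measurement (hSI : IsModel S I P) {k : ℕ}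
    {c : (Fin k → Fin m → Bool) → Matrix (Fin n) (Fin n) ℝ}
    {μ : (Fin k → Packet s) → EuclideanSpace ℝ (Fin n)}
    (h : CondGaussian P (state S I k) (info S I k) c μ)
    {G : (Fin k → Packet s) × EuclideanSpace ℝ (Fin n) × Packet s → ℝ≥0∞} (hG : Measurable G) :
    ∫⁻ ω, G (info S I k ω, state S I k ω, packet S I k ω) ∂P =
      ∫⁻ ω, ∫⁻ x, ∫⁻ v, ∫⁻ z, G (info S I k ω, x, packetFun S (S.stackedC *ᵥ x.ofLp + v.ofLp) z)
        ∂Measure.pi (fun _ : Fin m => unitUniform) ∂multivariateGaussian 0 S.R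
        ∂multivariateGaussian (μ (info S I k ω)) (c (decisionsOf (info S I k ω))) ∂P := by
  have hI := measurable_info S I k
  have hX := measurable_state S I k
  have hy : Continuous fun a : EuclideanSpace ℝ (Fin n) × EuclideanSpace ℝ (MeasIdx s) =>
      S.stackedC *ᵥ a.1.ofLp + a.2.ofLp := by fun_prop
  obtain ⟨Φ, hΦ⟩ : ∃ Φ, Φ = packetFun S := ⟨_, rfl⟩
  have hΦm : Measurable fun q : (MeasIdx s → ℝ) × (Fin m → ℝ) => Φ q.1 q.2 :=
    hΦ ▸ measurable_packetFun S
  have hp : Measurable fun q : ((Fin k → Packet s) × EuclideanSpace ℝ (Fin n)) ×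
      (EuclideanSpace ℝ (MeasIdx s) × (Fin m → ℝ)) =>
      (S.stackedC *ᵥ q.1.2.ofLp + q.2.1.ofLp, q.2.2) :=
    (hy.measurable.comp ((measurable_snd.comp measurable_fst).prodMk
      (measurable_fst.comp measurable_snd))).prodMk (measurable_snd.comp measurable_snd)
  have hpk : Measurable fun q : ((Fin k → Packet s) × EuclideanSpace ℝ (Fin n)) ×
      (EuclideanSpace ℝ (MeasIdx s) × (Fin m → ℝ)) =>
      Φ (S.stackedC *ᵥ q.1.2.ofLp + q.2.1.ofLp) q.2.2 := hΦm.comp hp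
  have hq : Measurable fun q : ((Fin k → Packet s) × EuclideanSpace ℝ (Fin n)) ×
      (EuclideanSpace ℝ (MeasIdx s) × (Fin m → ℝ)) =>
      (q.1.1, q.1.2, Φ (S.stackedC *ᵥ q.1.2.ofLp + q.2.1.ofLp) q.2.2) :=
    (measurable_fst.comp measurable_fst).prodMk ((measurable_snd.comp measurable_fst).prodMk hpk)
  have hF : Measurable fun q : ((Fin k → Packet s) × EuclideanSpace ℝ (Fin n)) ×
      (EuclideanSpace ℝ (MeasIdx s) × (Fin m → ℝ)) =>
      G (q.1.1, q.1.2, Φ (S.stackedC *ᵥ q.1.2.ofLp + q.2.1.ofLp) q.2.2) := hG.comp hq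
  have e1 := lintegral_of_indepFun (hI.prodMk hX) (I.measurable_v k)
    (measurable_pi_lambda _ (I.measurable_ζ k)) (hSI.indepFun_past_measurement k)
    (hSI.map_v_ζ k) hF
  have hF1 : Measurable fun q : (Fin k → Packet s) × EuclideanSpace ℝ (Fin n) =>
      ∫⁻ v, ∫⁻ z, G (q.1, q.2, Φ (S.stackedC *ᵥ q.2.ofLp + v.ofLp) z)
        ∂Measure.pi (fun _ : Fin m => unitUniform) ∂multivariateGaussian 0 S.R := by
    have hF2 : Measurable fun q : (((Fin k → Packet s) × EuclideanSpace ℝ (Fin n)) ×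
        EuclideanSpace ℝ (MeasIdx s)) × (Fin m → ℝ) =>
        G (q.1.1.1, q.1.1.2, Φ (S.stackedC *ᵥ q.1.1.2.ofLp + q.1.2.ofLp) q.2) :=
      hF.comp ((measurable_fst.comp measurable_fst).prodMk
        ((measurable_snd.comp measurable_fst).prodMk measurable_snd))
    exact hF2.lintegral_prod_right'.lintegral_prod_right'
  have e2 := h.lintegral_eq hX hI hF1
  simp only [packet_eq, stackedMeas_eq, ← hΦ]
  exact e1.trans e2

lemma measurable_snoc {k : ℕ} : Measurable fun q : (Fin k → Packet s) × Packet s =>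
    (Fin.snoc q.1 q.2 : Fin (k + 1) → Packet s) := by
  refine measurable_pi_lambda _ fun j => ?_
  refine Fin.lastCases ?_ (fun j => ?_) j
  · simpa only [Fin.snoc_last] using measurable_snd
  · simp only [Fin.snoc_castSucc]
    exact (measurable_pi_apply j).comp measurable_fst

lemma measurable_init {k : ℕ} :
    Measurable fun i : Fin (k + 1) → Packet s => (Fin.init i : Fin k → Packet s) :=
  measurable_pi_lambda _ fun j => measurable_pi_apply j.castSucc

lemma info_succ {k : ℕ} (ω : Ω) :
    info S I (k + 1) ω = Fin.snoc (info S I k ω) (packet S I k ω) := by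
  funext j
  refine Fin.lastCases ?_ (fun j => ?_) j
  · simp [info]
  · simp [info]

/-- The covariance after the measurement update. -/
noncomputable def SensorSystem.nextCov (S : SensorSystem n m s) {k : ℕ}
    (c : (Fin k → Fin m → Bool) → Matrix (Fin n) (Fin n) ℝ) (g : Fin (k + 1) → Fin m → Bool) :
    Matrix (Fin n) (Fin n) ℝ :=
  S.updateCov (c (Fin.init g)) (g (Fin.last k))

/-- The mean after the measurement update. -/
noncomputable def SensorSystem.nextMean (S : SensorSystem n m s) {k : ℕ}
    (c : (Fin k → Fin m → Bool) → Matrix (Fin n) (Fin n) ℝ)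
    (μ : (Fin k → Packet s) → EuclideanSpace ℝ (Fin n)) (i : Fin (k + 1) → Packet s) :
    EuclideanSpace ℝ (Fin n) :=
  S.updateMean (c (decisionsOf (Fin.init i))) (μ (Fin.init i)) (i (Fin.last k))

lemma measurable_nextMean (S : SensorSystem n m s) {k : ℕ}
    (c : (Fin k → Fin m → Bool) → Matrix (Fin n) (Fin n) ℝ)
    {μ : (Fin k → Packet s) → EuclideanSpace ℝ (Fin n)} (hμ : Measurable μ) :
    Measurable (S.nextMean c μ) := by
  have hg (g : (Fin k → Fin m → Bool) × (Fin m → Bool)) :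
      Measurable fun q : EuclideanSpace ℝ (Fin n) × (MeasIdx s → ℝ) =>
        posteriorMean (c g.1) S.stackedC (S.effectiveCov g.2) q.1 q.2 := by
    generalize c g.1 = M
    generalize S.effectiveCov g.2 = N
    exact Measurable.posteriorMean M S.stackedC N measurable_fst measurable_snd
  have h : Measurable fun q : ((Fin k → Fin m → Bool) × (Fin m → Bool)) ×
      (EuclideanSpace ℝ (Fin n) × (MeasIdx s → ℝ)) =>
      posteriorMean (c q.1.1) S.stackedC (S.effectiveCov q.1.2) q.2.1 q.2.2 :=
    measurable_from_prod_countable_right hg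
  have hl : Measurable fun i : Fin (k + 1) → Packet s => i (Fin.last k) := measurable_pi_apply _
  have h1 : Measurable fun i : Fin (k + 1) → Packet s =>
      decisionsOf (Fin.init i : Fin k → Packet s) :=
    measurable_decisionsOf.comp measurable_init
  have h2 : Measurable fun i : Fin (k + 1) → Packet s => (i (Fin.last k)).1 :=
    measurable_packet_fst.comp hl
  have h3 : Measurable fun i : Fin (k + 1) → Packet s => μ (Fin.init i : Fin k → Packet s) :=
    hμ.comp measurable_init
  have h4 : Measurable fun i : Fin (k + 1) → Packet s => (i (Fin.last k)).fill :=
    measurable_fill.comp hl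
  exact h.comp ((h1.prodMk h2).prodMk (h3.prodMk h4))

/-- The measurement update. -/
lemma IsModel.condGaussian_measurement (hSI : IsModel S I P) {k : ℕ}
    {c : (Fin k → Fin m → Bool) → Matrix (Fin n) (Fin n) ℝ}
    {μ : (Fin k → Packet s) → EuclideanSpace ℝ (Fin n)}
    (h : CondGaussian P (state S I k) (info S I k) c μ) :
    CondGaussian P (state S I k) (info S I (k + 1)) (S.nextCov c) (S.nextMean c μ) := by
  have hμ' := measurable_nextMean S c h.measurable_mean
  refine CondGaussian.of_lintegral_eq (measurable_state S I k) (measurable_info S I (k + 1)) hμ'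
    (fun g => posDef_updateCov S (h.posDef _) _) fun f φ hf hφ => ?_
  have hK : Measurable fun i => ∫⁻ x, φ x
      ∂multivariateGaussian (S.nextMean c μ i) (S.nextCov c (decisionsOf i)) :=
    measurable_lintegral_gaussian _ hμ' (F := fun q => φ q.2) (by fun_prop)
  have hsn : Measurable fun q : (Fin k → Packet s) × EuclideanSpace ℝ (Fin n) × Packet s =>
      (Fin.snoc q.1 q.2.2 : Fin (k + 1) → Packet s) :=
    measurable_snoc.comp (measurable_fst.prodMk (measurable_snd.comp measurable_snd))
  have e1 := hSI.lintegral_measurement h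
    (G := fun q => f (Fin.snoc q.1 q.2.2) * φ q.2.1)
    ((hf.comp hsn).mul (hφ.comp (measurable_fst.comp measurable_snd)))
  have e2 := hSI.lintegral_measurement h
    (G := fun q => f (Fin.snoc q.1 q.2.2) * ∫⁻ x, φ x
      ∂multivariateGaussian (S.nextMean c μ (Fin.snoc q.1 q.2.2))
        (S.nextCov c (decisionsOf (Fin.snoc q.1 q.2.2 : Fin (k + 1) → Packet s))))
    ((hf.comp hsn).mul (hK.comp hsn))
  simp only [info_succ]
  -- Both sides now share the outer integral over the past. With the past frozen, the claim is
  -- `lintegral_packet_update` with the past packets absorbed into the test function.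
  refine e1.trans (Eq.trans (lintegral_congr fun ω => ?_) e2.symm)
  have hs : Measurable fun p : Packet s =>
      (Fin.snoc (info S I k ω) p : Fin (k + 1) → Packet s) :=
    measurable_snoc.comp (g := fun q : (Fin k → Packet s) × Packet s =>
      (Fin.snoc q.1 q.2 : Fin (k + 1) → Packet s)) (f := fun p => (info S I k ω, p))
      (measurable_const.prodMk measurable_id)
  have key := lintegral_packet_update S (h.posDef (decisionsOf (info S I k ω)))
    (μ (info S I k ω)) (ψ := fun p => f (Fin.snoc (info S I k ω) p)) (h := φ)
    (hf.comp hs) hφ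
  have hinit : ∀ p : Packet s, decisionsOf (Fin.init
      (Fin.snoc (info S I k ω) p : Fin (k + 1) → Packet s)) = decisionsOf (info S I k ω) := by
    intro p
    rw [Fin.init_snoc]
  have hinit' : ∀ p : Packet s, Fin.init (decisionsOf
      (Fin.snoc (info S I k ω) p : Fin (k + 1) → Packet s)) = decisionsOf (info S I k ω) := hinit
  have hlast : ∀ p : Packet s, decisionsOf
      (Fin.snoc (info S I k ω) p : Fin (k + 1) → Packet s) (Fin.last k) = p.1 := by
    intro p
    simp [decisionsOf]
  simp only [SensorSystem.nextMean, SensorSystem.nextCov, hinit', hlast, Fin.init_snoc,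
    Fin.snoc_last]
  exact key

/-- The time update. -/
lemma IsModel.condGaussian_time (hSI : IsModel S I P) {k : ℕ}
    {c : (Fin (k + 1) → Fin m → Bool) → Matrix (Fin n) (Fin n) ℝ}
    {μ : (Fin (k + 1) → Packet s) → EuclideanSpace ℝ (Fin n)}
    (h : CondGaussian P (state S I k) (info S I (k + 1)) c μ) :
    CondGaussian P (state S I (k + 1)) (info S I (k + 1)) (fun g => S.A * c g * S.Aᵀ + S.Q)
      (fun i => S.A.toEuclideanLin (μ i)) := by
  have hA : Measurable S.A.toEuclideanLin :=
    S.A.toEuclideanLin.continuous_of_finiteDimensional.measurable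
  have hI := measurable_info S I (k + 1)
  have hX := measurable_state S I k
  have hw := I.measurable_w k
  refine CondGaussian.of_lintegral_eq (measurable_state S I (k + 1)) hI
    (hA.comp h.measurable_mean) (fun g => ?_) fun f φ hf hφ => ?_
  · rw [add_comm]
    exact (h.posDef g).add_mul_mul_transpose S.posDef_Q S.A
  have hind := hSI.indepFun_past_noise k
  rw [indepFun_iff_map_prod_eq_prod_map_map (hI.prodMk hX).aemeasurable
    hw.aemeasurable, hSI.map_w] at hind
  have hF : Measurable fun q : ((Fin (k + 1) → Packet s) × EuclideanSpace ℝ (Fin n)) ×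
      EuclideanSpace ℝ (Fin n) => f q.1.1 * φ (S.A.toEuclideanLin q.1.2 + q.2) := by
    fun_prop
  have hF1 := hF.lintegral_prod_right' (ν := multivariateGaussian 0 S.Q)
  calc _ = ∫⁻ q, f q.1.1 * φ (S.A.toEuclideanLin q.1.2 + q.2)
        ∂P.map (fun ω => ((info S I (k + 1) ω, state S I k ω), I.w k ω)) := by
        rw [lintegral_map hF ((hI.prodMk hX).prodMk hw)]
        rfl
    _ = _ := by
        rw [hind, lintegral_prod _ hF.aemeasurable, lintegral_map hF1 (hI.prodMk hX),
          h.lintegral_eq hX hI hF1]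
        refine lintegral_congr fun ω => ?_
        rw [← lintegral_multivariateGaussian_linear S.A _ (h.posDef _).posSemidef
          S.posDef_Q.posSemidef hφ, ← lintegral_const_mul]
        · refine lintegral_congr fun x => ?_
          have hw' : Measurable fun w => φ (S.A.toEuclideanLin x + w) := by fun_prop
          exact lintegral_const_mul (f (info S I (k + 1) ω)) hw'
        · exact Measurable.lintegral_prod_right'
            (f := fun q : EuclideanSpace ℝ (Fin n) × EuclideanSpace ℝ (Fin n) =>
              φ (S.A.toEuclideanLin q.1 + q.2)) (by fun_prop)

lemma IsModel.exists_condGaussian (hSI : IsModel S I P) (k : ℕ) :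
    ∃ c μ, CondGaussian P (state S I k) (info S I k) c μ := by
  induction k with
  | zero => exact ⟨_, _, condGaussian_zero hSI⟩
  | succ k ih =>
    obtain ⟨c, μ, h⟩ := ih
    exact ⟨_, _, hSI.condGaussian_time (hSI.condGaussian_measurement h)⟩

end Recursion

end EventEstimation

-- From conditional laws to estimates and error covariances.

namespace EventEstimation

variable {Ω : Type*} {n m : ℕ} {s : Fin m → ℕ}

lemma integral_eval_multivariateGaussian {ι : Type*} [Fintype ι] [DecidableEq ι]
    (μ : EuclideanSpace ℝ ι) (M : Matrix ι ι ℝ) (i : ι) :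
    ∫ x, x.ofLp i ∂multivariateGaussian μ M = μ i := by
  have h : ∫ x, x.ofLp i ∂multivariateGaussian μ M =
      (∫ x, x ∂multivariateGaussian μ M).ofLp i :=
    ContinuousLinearMap.integral_comp_comm (EuclideanSpace.proj (𝕜 := ℝ) i)
      (IsGaussian.memLp_two_id.integrable (by norm_num))
  rw [h, integral_id_multivariateGaussian]

lemma memLp_eval {ι : Type*} [Fintype ι] [MeasurableSpace Ω] {P : Measure Ω} {p : ℝ≥0∞}
    {X : Ω → EuclideanSpace ℝ ι} (hX : MemLp X p P) (i : ι) : MemLp (fun ω => X ω i) p P :=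
  (EuclideanSpace.proj (𝕜 := ℝ) i).comp_memLp' hX

section Moments

variable [MeasurableSpace Ω] {P : Measure Ω} [IsProbabilityMeasure P] {l : ℕ}
  {X : Ω → EuclideanSpace ℝ (Fin n)} {Z : Ω → Fin l → Packet s}
  {c : (Fin l → Fin m → Bool) → Matrix (Fin n) (Fin n) ℝ}
  {μ : (Fin l → Packet s) → EuclideanSpace ℝ (Fin n)}

/-- Disintegrations of a joint law are almost surely unique. -/
lemma CondGaussian.condDistrib_ae_eq (h : CondGaussian P X Z c μ) (hX : Measurable X)
    (hZ : Measurable Z) :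
    ∀ᵐ ω ∂P, condDistrib X Z P (Z ω) = multivariateGaussian (μ (Z ω)) (c (decisionsOf (Z ω))) :=
  ae_of_ae_map hZ.aemeasurable
    (condDistrib_ae_eq_of_measure_eq_compProd Z hX.aemeasurable h.map_eq)

lemma CondGaussian.condExp_ae_eq (h : CondGaussian P X Z c μ) (hX : Measurable X)
    (hZ : Measurable Z) (hX2 : MemLp X 2 P) :
    P[X | MeasurableSpace.comap Z inferInstance] =ᵐ[P] fun ω => μ (Z ω) := by
  filter_upwards [condExp_ae_eq_integral_condDistrib' hZ (hX2.integrable (by norm_num)),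
    h.condDistrib_ae_eq hX hZ] with ω h1 h2
  rw [h1, h2, integral_id_multivariateGaussian]

lemma CondGaussian.condExp_mul_ae_eq (h : CondGaussian P X Z c μ) (hX : Measurable X)
    (hZ : Measurable Z) (hX2 : MemLp X 2 P) (i j : Fin n) :
    P[fun ω => (X ω i - P[X | MeasurableSpace.comap Z inferInstance] ω i) *
        (X ω j - P[X | MeasurableSpace.comap Z inferInstance] ω j) |
          MeasurableSpace.comap Z inferInstance] =ᵐ[P] fun ω => c (decisionsOf (Z ω)) i j := by
  have hE := h.condExp_ae_eq hX hZ hX2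
  -- Conditional expectation preserves square integrability, so the error products below are
  -- integrable.
  have hμ2 : MemLp (fun ω => μ (Z ω)) 2 P := (hX2.condExp (by norm_num)).ae_eq hE
  have hi (i : Fin n) : MemLp (fun ω => X ω i - μ (Z ω) i) 2 P :=
    (memLp_eval hX2 i).sub (memLp_eval hμ2 i)
  have hμ := h.measurable_mean
  have hf : Measurable fun q : (Fin l → Packet s) × EuclideanSpace ℝ (Fin n) =>
      (q.2 i - μ q.1 i) * (q.2 j - μ q.1 j) := by
    have h1 : Measurable fun q : (Fin l → Packet s) × EuclideanSpace ℝ (Fin n) => μ q.1 :=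
      hμ.comp measurable_fst
    fun_prop
  have h1 : (fun ω => (X ω i - P[X | MeasurableSpace.comap Z inferInstance] ω i) *
      (X ω j - P[X | MeasurableSpace.comap Z inferInstance] ω j)) =ᵐ[P]
      fun ω => (X ω i - μ (Z ω) i) * (X ω j - μ (Z ω) j) := by
    filter_upwards [hE] with ω hω
    rw [hω]
  refine (condExp_congr_ae h1).trans ?_
  filter_upwards [condExp_prod_ae_eq_integral_condDistrib (Y := X) hZ hX.aemeasurable
    hf.stronglyMeasurable ((hi i).integrable_mul (hi j)), h.condDistrib_ae_eq hX hZ] with ω h2 h3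
  rw [h2, h3, ← covariance_eval_multivariateGaussian (μ := μ (Z ω)) (h.posDef _).posSemidef i j,
    covariance, integral_eval_multivariateGaussian, integral_eval_multivariateGaussian]

end Moments

section Estimation

variable [MeasurableSpace Ω] {P : Measure Ω} [IsProbabilityMeasure P] {S : SensorSystem n m s}
  {I : RandomInputs Ω n m s}

lemma IsModel.memLp_state (hSI : IsModel S I P) (k : ℕ) : MemLp (state S I k) 2 P := by
  induction k with
  | zero => exact hSI.hasGaussianLaw_x0.memLp_two
  | succ k ih =>
    exact ((LinearMap.toContinuousLinearMap S.A.toEuclideanLin).comp_memLp' ih).add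
      (hSI.hasGaussianLaw_w k).memLp_two

lemma IsModel.estimate_ae_eq (hSI : IsModel S I P) {k l : ℕ}
    {c : (Fin l → Fin m → Bool) → Matrix (Fin n) (Fin n) ℝ}
    {μ : (Fin l → Packet s) → EuclideanSpace ℝ (Fin n)}
    (h : CondGaussian P (state S I k) (info S I l) c μ) :
    ∀ᵐ ω ∂P, estimate S I P k l ω = μ (info S I l ω) :=
  h.condExp_ae_eq (measurable_state S I k) (measurable_info S I l) (hSI.memLp_state k)

lemma IsModel.errorCov_ae_eq (hSI : IsModel S I P) {k l : ℕ}
    {c : (Fin l → Fin m → Bool) → Matrix (Fin n) (Fin n) ℝ}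
    {μ : (Fin l → Packet s) → EuclideanSpace ℝ (Fin n)}
    (h : CondGaussian P (state S I k) (info S I l) c μ) :
    ∀ᵐ ω ∂P, errorCov S I P k l ω = c (decisionsOf (info S I l ω)) := by
  have h1 : ∀ᵐ ω ∂P, ∀ i j, errorCov S I P k l ω i j = c (decisionsOf (info S I l ω)) i j :=
    ae_all_iff.2 fun i => ae_all_iff.2 fun j =>
      h.condExp_mul_ae_eq (measurable_state S I k) (measurable_info S I l) (hSI.memLp_state k) i j
  filter_upwards [h1] with ω hω
  ext i j
  exact hω i j

lemma IsModel.condDistrib_estimate (hSI : IsModel S I P) {k l : ℕ}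
    {c : (Fin l → Fin m → Bool) → Matrix (Fin n) (Fin n) ℝ}
    {μ : (Fin l → Packet s) → EuclideanSpace ℝ (Fin n)}
    (h : CondGaussian P (state S I k) (info S I l) c μ) :
    ∀ᵐ ω ∂P, (errorCov S I P k l ω).PosDef ∧
      condDistrib (state S I k) (info S I l) P (info S I l ω) =
        multivariateGaussian (estimate S I P k l ω) (errorCov S I P k l ω) := by
  filter_upwards [hSI.estimate_ae_eq h, hSI.errorCov_ae_eq h,
    h.condDistrib_ae_eq (measurable_state S I k) (measurable_info S I l)] with ω h1 h2 h3
  rw [h1, h2, h3]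
  exact ⟨h.posDef _, rfl⟩

lemma decisionMatrix_eq_diagonal (S : SensorSystem n m s) (I : RandomInputs Ω n m s) (k : ℕ)
    (ω : Ω) : decisionMatrix S I k ω =
      diagonal fun q : MeasIdx s => if Transmitted (decision S I k ω) q then 1 else 0 := by
  have h : ∀ i, (if decision S I k ω i = true then (1 : ℝ) else 0) •
      (1 : Matrix (Fin (s i)) (Fin (s i)) ℝ) =
      diagonal fun _ => if decision S I k ω i = true then 1 else 0 := fun i => by
    rw [smul_one_eq_diagonal]
  simp only [decisionMatrix, h, blockDiagonal'_diagonal]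

lemma one_sub_decisionMatrix (S : SensorSystem n m s) (I : RandomInputs Ω n m s) (k : ℕ)
    (ω : Ω) : 1 - decisionMatrix S I k ω = dropDiag (Transmitted (decision S I k ω)) := by
  rw [decisionMatrix_eq_diagonal, ← diagonal_one, diagonal_sub, dropDiag]
  congr 1
  ext q
  split_ifs <;> simp

lemma fill_packet (S : SensorSystem n m s) (I : RandomInputs Ω n m s) (k : ℕ) (ω : Ω) :
    (packet S I k ω).fill = decisionMatrix S I k ω *ᵥ (stackedMeas S I k ω).ofLp := by
  rw [packet_eq, packetFun, fill_packOf, ← decision_eq, decisionMatrix_eq_diagonal]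
  ext q
  rw [mulVec_diagonal, zeroFill]
  split_ifs <;> simp

lemma nextMean_info_succ {k : ℕ} (c : (Fin k → Fin m → Bool) → Matrix (Fin n) (Fin n) ℝ)
    (μ : (Fin k → Packet s) → EuclideanSpace ℝ (Fin n)) (ω : Ω) :
    S.nextMean c μ (info S I (k + 1) ω) =
      posteriorMean (c (decisionsOf (info S I k ω))) S.stackedC
        (S.effectiveCov (decision S I k ω)) (μ (info S I k ω))
        (decisionMatrix S I k ω *ᵥ (stackedMeas S I k ω).ofLp) := by
  rw [info_succ, SensorSystem.nextMean, Fin.init_snoc, Fin.snoc_last, SensorSystem.updateMean,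
    fill_packet]
  rfl

lemma nextCov_info_succ {k : ℕ} (c : (Fin k → Fin m → Bool) → Matrix (Fin n) (Fin n) ℝ) (ω : Ω) :
    S.nextCov c (decisionsOf (info S I (k + 1) ω)) =
      posteriorCov (c (decisionsOf (info S I k ω))) S.stackedC
        (S.effectiveCov (decision S I k ω)) := rfl

end Estimation

end EventEstimation

open EventEstimation

theorem theorem1 {Ω : Type*} [MeasurableSpace Ω] (P : Measure Ω) [IsProbabilityMeasure P]
    {n m : ℕ} {s : Fin m → ℕ} (S : EventEstimation.SensorSystem n m s)
    (I : EventEstimation.RandomInputs Ω n m s) (hSI : EventEstimation.IsModel S I P) :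
    -- the conditional first and second moments are those of square integrable states
    (∀ k, MemLp (EventEstimation.state S I k) 2 P) ∧
    -- initial values
    (∀ᵐ ω ∂P, EventEstimation.priorMean S I P 0 ω = 0 ∧
      EventEstimation.priorCov S I P 0 ω = S.S0) ∧
    -- the conditional laws are (nondegenerate) Gaussian
    (∀ k, ∀ᵐ ω ∂P, (EventEstimation.priorCov S I P k ω).PosDef ∧
      condDistrib (EventEstimation.state S I k) (EventEstimation.info S I k) P
          (EventEstimation.info S I k ω) =
        multivariateGaussian (EventEstimation.priorMean S I P k ω)
          (EventEstimation.priorCov S I P k ω)) ∧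
    (∀ k, ∀ᵐ ω ∂P, (EventEstimation.postCov S I P k ω).PosDef ∧
      condDistrib (EventEstimation.state S I k) (EventEstimation.info S I (k + 1)) P
          (EventEstimation.info S I (k + 1) ω) =
        multivariateGaussian (EventEstimation.postMean S I P k ω)
          (EventEstimation.postCov S I P k ω)) ∧
    -- time update
    (∀ k, ∀ᵐ ω ∂P,
      EventEstimation.priorMean S I P (k + 1) ω =
        S.A.toEuclideanLin (EventEstimation.postMean S I P k ω) ∧
      EventEstimation.priorCov S I P (k + 1) ω =
        S.A * EventEstimation.postCov S I P k ω * S.Aᵀ + S.Q) ∧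
    -- measurement update
    (∀ k, ∀ᵐ ω ∂P,
      EventEstimation.postMean S I P k ω =
        EventEstimation.priorMean S I P k ω +
          (EventEstimation.gain S I P k ω).toEuclideanLin
            ((EventEstimation.decisionMatrix S I k ω).toEuclideanLin
                (EventEstimation.stackedMeas S I k ω) -
              S.stackedC.toEuclideanLin (EventEstimation.priorMean S I P k ω)) ∧
      EventEstimation.postCov S I P k ω =
        EventEstimation.priorCov S I P k ω -
          EventEstimation.gain S I P k ω * S.stackedC * EventEstimation.priorCov S I P k ω) := by
  have hprior := hSI.exists_condGaussian
  refine ⟨hSI.memLp_state, ?_, fun k => ?_, fun k => ?_, fun k => ?_, fun k => ?_⟩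
  · have h := condGaussian_zero hSI
    filter_upwards [hSI.estimate_ae_eq h, hSI.errorCov_ae_eq h] with ω h1 h2
    exact ⟨h1, h2⟩
  · obtain ⟨c, μ, h⟩ := hprior k
    exact hSI.condDistrib_estimate h
  · obtain ⟨c, μ, h⟩ := hprior k
    exact hSI.condDistrib_estimate (hSI.condGaussian_measurement h)
  -- The posterior and the next prior are both built from this one pair `c`, `μ`, so the update
  -- holds by definition of the representatives.
  · obtain ⟨c, μ, h⟩ := hprior k
    have h' := hSI.condGaussian_measurement h
    have h'' := hSI.condGaussian_time h'
    filter_upwards [hSI.estimate_ae_eq h', hSI.errorCov_ae_eq h', hSI.estimate_ae_eq h'',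
      hSI.errorCov_ae_eq h''] with ω h1 h2 h3 h4
    simp only [priorMean, postMean, priorCov, postCov]
    rw [h1, h2, h3, h4]
    exact ⟨rfl, rfl⟩
  · obtain ⟨c, μ, h⟩ := hprior k
    have h' := hSI.condGaussian_measurement h
    filter_upwards [hSI.estimate_ae_eq h, hSI.errorCov_ae_eq h, hSI.estimate_ae_eq h',
      hSI.errorCov_ae_eq h'] with ω h1 h2 h3 h4
    -- The term `(1 - Ψ) Y⁻¹` of the gain is exactly the extra noise in `effectiveCov`.
    have hg : gain S I P k ω = c (decisionsOf (info S I k ω)) * S.stackedCᵀ *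
        (S.stackedC * c (decisionsOf (info S I k ω)) * S.stackedCᵀ +
          S.effectiveCov (decision S I k ω))⁻¹ := by
      rw [gain, priorCov, h2, one_sub_decisionMatrix, add_assoc, SensorSystem.effectiveCov]
    simp only [priorMean, postMean, priorCov, postCov]
    rw [h1, h2, h3, h4, hg, nextMean_info_succ, nextCov_info_succ]
    exact ⟨rfl, rfl⟩
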